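/- Let $R$ be a commutative ring and let $H$ be a Hopf $R$-algebra with a twisted antipode $\overline S$, i.e. an $R$-linear map $\overline S:H\to H$ with $\sum \overline S(h_2)h_1=\varepsilon(h)1_H=\sum h_2\overline S(h_1)$ for all $h\in H$. Let $H^*=\mathrm{Hom}_R(H,R)$ carry the convolution product $\star$ and the right $H$-action $(fh)(k)=f(hk)$; let $H^*$ act on $H$ by $f\rightharpoonup k=\sum k_1f(k_2)$ and $k\leftharpoonup f=\sum f(k_1)k_2$. *Crossed product.* Let $A$ be a (unital, associative) $R$-algebra with a weak left $H$-action, i.e. an $R$-linear map $H\otimes_R A\to A$, $h\otimes a\mapsto ha$, with $h(ab)=\sum(h_1a)(h_2b)$, $h1_A=\varepsilon(h)1_A$ and $1_Ha=a$. Let $\sigma:H\otimes_R H\to A$ be $R$-linear and convolution invertible with inverse $\sigma^{-1}$, and assume that $A\#_\sigma H:=A\otimes_R H$ with the multiplication $$(a\#h)(b\#k)=\sum a(h_1b)\sigma(h_2\otimes k_1)\#h_3k_2$$ is associative with unity $1_A\#1_H$. It is a right $H$-comodule algebra through $\mathrm{id}_A\otimes\Delta$, and $H$ is one through $\Delta$.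 *Smash products.* Let $U\subseteq H^*$ be a right $H$-module subalgebra (an $R$-submodule closed under $\star$ and under the right $H$-action, not necessarily containing $\varepsilon$). For a right $H$-comodule algebra $B$ let $B\#U:=B\otimes_R U$ with the multiplication $$(b\#f)(b'\#f')=\sum bb'_{<0>}\#(fb'_{<1>})\star f'.$$ *Compatibility.* Let $V\subseteq H^*$ be a right $H$-submodule such that $(V,U)$ is compatible, that is: 1. the images of the maps $\varphi,\psi:H\otimes_R A\to\mathrm{Hom}_R(H,A)$, $$\varphi(h\otimes a)(k)=\sum(\overline S(k_2)a)\,\sigma(\overline S(k_1)\otimes h),\qquad \psi(h\otimes a)(k)=\sum\sigma^{-1}(k_3\otimes\overline S(k_2))\,(k_4a)\,\sigma(k_5\otimes\overline S(k_1)h),$$ are contained in the image of $J:A\otimes_R V\to\mathrm{Hom}_R(H,A)$, $a\otimes v\mapsto[k\mapsto v(k)a]$; 2. (RL-condition) for every $g\in V$ there are finitely many $(h_j,g_j)\in H\times U$ with $k\leftharpoonup g=\sum_j h_j(g_j\rightharpoonup k)$ for all $k\in H$. If the canonical map $\alpha:(A\otimes_R H)\otimes_R U\to\mathrm{Hom}_R(H,A\otimes_R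 H)$, $x\otimes f\mapsto[k\mapsto f(k)x]$, is injective, then there is an isomorphism of $R$-algebras (an $R$-linear bijection preserving products, and the units $(1_A\#1_H)\#\varepsilon$ and $1_A\otimes(1_H\#\varepsilon)$ in case $\varepsilon\in U$) $$(A\#_\sigma H)\#U\;\cong\;A\otimes_R(H\#U).$$ -/

import Mathlib

open scoped TensorProduct

noncomputable section

namespace CrossedDuality

open Coalgebra WithConv

/-! ### Pairings and dual actions -/

/-- For a pairing `β : V → W^*` of `R`-modules and an `R`-module `M`, the canonical map
`M ⊗ V → Hom_R(W, M)`, `m ⊗ v ↦ [w ↦ β(v)(w) m]`. -/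
def pairingMap {R W V : Type*} (M : Type*) [CommRing R] [AddCommMonoid W] [Module R W]
    [AddCommMonoid V] [Module R V] [AddCommMonoid M] [Module R M]
    (β : V →ₗ[R] Module.Dual R W) : M ⊗[R] V →ₗ[R] (W →ₗ[R] M) :=
  TensorProduct.lift
    (LinearMap.mk₂ R (fun (m : M) (v : V) => (β v).smulRight m)
      (fun _ _ _ => by ext; simp)
      (fun _ _ _ => by ext; exact smul_comm _ _ _)
      (fun _ _ _ => by ext; simp [add_smul])
      (fun _ _ _ => by ext; simp [mul_smul]))

section Hopf

variable {R H : Type*} [CommRing R] [Ring H] [Bialgebra R H]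

/-- The left action `f ⇀ k = ∑ k₁ f(k₂)` of `H^*` on `H`. -/
def leftHit : Module.Dual R H →ₗ[R] H →ₗ[R] H where
  toFun f := (TensorProduct.rid R H).toLinearMap ∘ₗ f.lTensor H ∘ₗ comul
  map_add' f g := by simp [LinearMap.lTensor_add, LinearMap.add_comp, LinearMap.comp_add]
  map_smul' r f := by simp [LinearMap.lTensor_smul, LinearMap.smul_comp, LinearMap.comp_smul]

/-- The right action `k ↼ g = ∑ g(k₁) k₂` of `H^*` on `H`, as the endomorphism `ρ(g)` of `H`. -/
def rightHit : Module.Dual R H →ₗ[R] H →ₗ[R] H where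
  toFun g := (TensorProduct.lid R H).toLinearMap ∘ₗ g.rTensor H ∘ₗ comul
  map_add' f g := by simp [LinearMap.rTensor_add, LinearMap.add_comp, LinearMap.comp_add]
  map_smul' r f := by simp [LinearMap.rTensor_smul, LinearMap.smul_comp, LinearMap.comp_smul]

/-- The right regular action `(f h)(k) = f(h k)` of `H` on `H^*`. -/
def rightReg (f : Module.Dual R H) : H →ₗ[R] Module.Dual R H :=
  (LinearMap.mul R H).compr₂ f

/-- `Sb` is a twisted antipode of `H`, i.e. an antipode of `H^{op}`:
`∑ Sb(h₂) h₁ = ε(h) 1 = ∑ h₂ Sb(h₁)`. -/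
structure IsTwistedAntipode (Sb : H →ₗ[R] H) : Prop where
  antipode_mul : LinearMap.mul' R H ∘ₗ Sb.rTensor H ∘ₗ (TensorProduct.comm R H H).toLinearMap ∘ₗ
    comul = Algebra.linearMap R H ∘ₗ counit
  mul_antipode : LinearMap.mul' R H ∘ₗ Sb.lTensor H ∘ₗ (TensorProduct.comm R H H).toLinearMap ∘ₗ
    comul = Algebra.linearMap R H ∘ₗ counit

variable (R H) in
/-- A right `H`-module subalgebra `U` of the convolution algebra `H^*`, not required to contain
the unit `ε` of `H^*`. -/
structure RightModuleSubalgebra extends NonUnitalSubalgebra R (WithConv (Module.Dual R H)) where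
  rightReg_mem : ∀ f ∈ toNonUnitalSubalgebra, ∀ h : H,
    toConv (rightReg f.ofConv h) ∈ toNonUnitalSubalgebra

/-- The elements of `U`. -/
abbrev RightModuleSubalgebra.Elem (U : RightModuleSubalgebra R H) : Type _ :=
  U.toNonUnitalSubalgebra

/-- The inclusion `U → H^*`. -/
def RightModuleSubalgebra.incl (U : RightModuleSubalgebra R H) :
    U.Elem →ₗ[R] Module.Dual R H where
  toFun f := f.1.ofConv
  map_add' _ _ := rfl
  map_smul' _ _ := rfl

/-- The right action of `H` on `U`, `(f h)(k) = f(h k)`. -/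
def RightModuleSubalgebra.act (U : RightModuleSubalgebra R H) : U.Elem →ₗ[R] H →ₗ[R] U.Elem :=
  LinearMap.mk₂ R (fun f h => ⟨toConv (rightReg f.1.ofConv h), U.rightReg_mem f.1 f.2 h⟩)
    (fun _ _ _ => by ext; simp [rightReg])
    (fun _ _ _ => by ext; simp [rightReg])
    (fun _ _ _ => by ext; simp [rightReg])
    (fun _ _ _ => by ext; simp [rightReg])

/-! ### Smash products `B # U` -/

section Smash

variable {B : Type*} [NonUnitalNonAssocRing B] [Module R B] [IsScalarTower R B B]
  [SMulCommClass R B B]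

/-- The `R`-module `B ⊗ U` underlying the smash product `B # U`, where `δ : B → B ⊗ H` is the
coaction of a right `H`-comodule algebra `B`. -/
def Smash (_δ : B →ₗ[R] B ⊗[R] H) (U : RightModuleSubalgebra R H) : Type _ := B ⊗[R] U.Elem

namespace Smash

variable (δ : B →ₗ[R] B ⊗[R] H) (U : RightModuleSubalgebra R H)

instance : AddCommGroup (Smash δ U) := inferInstanceAs (AddCommGroup (B ⊗[R] U.Elem))

instance : Module R (Smash δ U) := inferInstanceAs (Module R (B ⊗[R] U.Elem))

/-- The element `b # f`. -/
def mk (b : B) (f : U.Elem) : Smash δ U := b ⊗ₜ[R] f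

/-- The product `(b # f)(b' # f') = ∑ b b'₍₀₎ # (f b'₍₁₎) ⋆ f'` as an `R`-bilinear map. -/
def mulMap : B ⊗[R] U.Elem →ₗ[R] B ⊗[R] U.Elem →ₗ[R] B ⊗[R] U.Elem :=
  TensorProduct.lift
    (LinearMap.mk₂ R
      (fun (b : B) (f : U.Elem) =>
        TensorProduct.map (LinearMap.mul R B b)
          (TensorProduct.lift (LinearMap.mul R U.Elem ∘ₗ U.act f)) ∘ₗ
        (TensorProduct.assoc R B H U.Elem).toLinearMap ∘ₗ δ.rTensor U.Elem)
      (fun _ _ _ => by rw [map_add, TensorProduct.map_add_left, LinearMap.add_comp])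
      (fun _ _ _ => by rw [map_smul, TensorProduct.map_smul_left, LinearMap.smul_comp])
      (fun _ _ _ => by
        rw [← LinearMap.add_comp, ← TensorProduct.map_add_right]
        congr 2
        ext : 3
        simp)
      (fun _ _ _ => by
        rw [← LinearMap.smul_comp, ← TensorProduct.map_smul_right]
        congr 2
        ext : 3
        simp))

instance : Mul (Smash δ U) := ⟨fun x y => mulMap δ U x y⟩

theorem mul_def (x y : Smash δ U) : x * y = mulMap δ U x y := rfl

instance : NonUnitalNonAssocRing (Smash δ U) where
  left_distrib x y z := (mulMap δ U x).map_add y z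
  right_distrib x y z := (mulMap δ U).map_add₂ x y z
  zero_mul x := (mulMap δ U).map_zero₂ x
  mul_zero x := (mulMap δ U x).map_zero

instance : IsScalarTower R (Smash δ U) (Smash δ U) :=
  ⟨fun r x y => (mulMap δ U).map_smul₂ r x y⟩

instance : SMulCommClass R (Smash δ U) (Smash δ U) :=
  ⟨fun r x y => ((mulMap δ U x).map_smul r y).symm⟩

end Smash

end Smash

/-- The smash product `H # U`, where `H` is a right `H`-comodule algebra through `Δ`. -/
abbrev SmashSelf (U : RightModuleSubalgebra R H) : Type _ :=
  Smash (comul : H →ₗ[R] H ⊗[R] H) U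

/-- The map `λ : H ⊗ U → End_R(H)`, `h ⊗ f ↦ [k ↦ h (f ⇀ k)]`. -/
def lambdaMap (U : RightModuleSubalgebra R H) : H ⊗[R] U.Elem →ₗ[R] (H →ₗ[R] H) :=
  TensorProduct.lift
    (LinearMap.mk₂ R (fun (h : H) (f : U.Elem) => LinearMap.mul R H h ∘ₗ leftHit (U.incl f))
      (fun _ _ _ => by rw [map_add, LinearMap.add_comp])
      (fun _ _ _ => by rw [map_smul, LinearMap.smul_comp])
      (fun _ _ _ => by rw [map_add, map_add, LinearMap.comp_add])
      (fun _ _ _ => by rw [map_smul, map_smul, LinearMap.comp_smul]))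

/-- The RL-condition for `(V, U)` with respect to `H`: `ρ(V) ⊆ λ(H # U)`. -/
def RLCondition (V : Submodule R (Module.Dual R H)) (U : RightModuleSubalgebra R H) : Prop :=
  ∀ g ∈ V, rightHit g ∈ LinearMap.range (lambdaMap U)

/-! ### Crossed products `A #_σ H` -/

section Crossed

variable {A : Type*} [Ring A] [Algebra R A]

variable (R H A) in
/-- A weak left `H`-action on `A`: an `R`-linear map `H ⊗ A → A` (in curried form) such that
`a ↦ [h ↦ h a]` is a morphism of `R`-algebras from `A` to the convolution algebra `Hom_R(H, A)`,
and such that `1_H a = a`. -/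
structure WeakAction where
  act : H →ₗ[R] A →ₗ[R] A
  flip_one : toConv (act.flip 1) = 1
  flip_mul : ∀ a b : A, toConv (act.flip (a * b)) = toConv (act.flip a) * toConv (act.flip b)
  one_act : ∀ a : A, act 1 a = a

/-- The `R`-module `A ⊗ H` underlying `A #_σ H`. -/
def Crossed (_w : WeakAction R H A) (_σ : H ⊗[R] H →ₗ[R] A) : Type _ := A ⊗[R] H

namespace Crossed

variable (w : WeakAction R H A) (σ : H ⊗[R] H →ₗ[R] A)

instance : AddCommGroup (Crossed w σ) := inferInstanceAs (AddCommGroup (A ⊗[R] H))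

instance : Module R (Crossed w σ) := inferInstanceAs (Module R (A ⊗[R] H))

/-- The element `a # h`. -/
def mk (a : A) (h : H) : Crossed w σ := a ⊗ₜ[R] h

variable (R H) in
/-- `h ⊗ k ↦ ∑ h₁ ⊗ ((h₂ ⊗ k₁) ⊗ (h₃ ⊗ k₂))`. -/
def legs : H ⊗[R] H →ₗ[R] H ⊗[R] ((H ⊗[R] H) ⊗[R] (H ⊗[R] H)) :=
  (comul : H ⊗[R] H →ₗ[R] (H ⊗[R] H) ⊗[R] (H ⊗[R] H)).lTensor H ∘ₗ
    (TensorProduct.assoc R H H H).toLinearMap ∘ₗ (comul : H →ₗ[R] H ⊗[R] H).rTensor H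

/-- For fixed `b`, the map `h ⊗ k ↦ ∑ (h₁ b) σ(h₂ ⊗ k₁) ⊗ h₃ k₂`. -/
def core (b : A) : H ⊗[R] H →ₗ[R] A ⊗[R] H :=
  (LinearMap.mul' R A).rTensor H ∘ₗ (TensorProduct.assoc R A A H).symm.toLinearMap ∘ₗ
    TensorProduct.map (w.act.flip b) (TensorProduct.map σ (LinearMap.mul' R H)) ∘ₗ legs R H

/-- The product `(a # h)(b # k) = ∑ a (h₁ b) σ(h₂ ⊗ k₁) # h₃ k₂` as an `R`-bilinear map. -/
def mulMap : A ⊗[R] H →ₗ[R] A ⊗[R] H →ₗ[R] A ⊗[R] H :=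
  TensorProduct.lift
    (LinearMap.mk₂ R
      (fun (a : A) (h : H) =>
        TensorProduct.lift
          (LinearMap.mk₂ R
            (fun (b : A) (k : H) => (LinearMap.mul R A a).rTensor H (core w σ b (h ⊗ₜ[R] k)))
            (fun _ _ _ => by simp [core, TensorProduct.map_add_left])
            (fun _ _ _ => by simp [core, TensorProduct.map_smul_left])
            (fun _ _ _ => by simp [TensorProduct.tmul_add])
            (fun _ _ _ => by simp)))
      (fun _ _ _ => by
        refine TensorProduct.ext' fun _ _ => ?_
        simp only [TensorProduct.lift.tmul, LinearMap.mk₂_apply, LinearMap.add_apply,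
          map_add, LinearMap.rTensor_add]
        rfl)
      (fun _ _ _ => by
        refine TensorProduct.ext' fun _ _ => ?_
        simp only [TensorProduct.lift.tmul, LinearMap.mk₂_apply, LinearMap.smul_apply,
          map_smul, LinearMap.rTensor_smul]
        rfl)
      (fun _ _ _ => by
        refine TensorProduct.ext' fun _ _ => ?_
        simp only [TensorProduct.lift.tmul, LinearMap.mk₂_apply, LinearMap.add_apply,
          map_add, TensorProduct.add_tmul]
        rfl)
      (fun _ _ _ => by
        refine TensorProduct.ext' fun _ _ => ?_
        simp only [TensorProduct.lift.tmul, LinearMap.mk₂_apply, LinearMap.smul_apply,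
          map_smul, ← TensorProduct.smul_tmul']
        rfl))

instance : Mul (Crossed w σ) := ⟨fun x y => mulMap w σ x y⟩

theorem mul_def (x y : Crossed w σ) : x * y = mulMap w σ x y := rfl

instance : NonUnitalNonAssocRing (Crossed w σ) where
  left_distrib x y z := (mulMap w σ x).map_add y z
  right_distrib x y z := (mulMap w σ).map_add₂ x y z
  zero_mul x := (mulMap w σ).map_zero₂ x
  mul_zero x := (mulMap w σ x).map_zero

instance : IsScalarTower R (Crossed w σ) (Crossed w σ) :=
  ⟨fun r x y => (mulMap w σ).map_smul₂ r x y⟩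

instance : SMulCommClass R (Crossed w σ) (Crossed w σ) :=
  ⟨fun r x y => ((mulMap w σ x).map_smul r y).symm⟩

/-- The right `H`-coaction `id ⊗ Δ` on `A #_σ H`. -/
def coaction : Crossed w σ →ₗ[R] Crossed w σ ⊗[R] H :=
  ((TensorProduct.assoc R A H H).symm.toLinearMap ∘ₗ (comul : H →ₗ[R] H ⊗[R] H).lTensor A :
    A ⊗[R] H →ₗ[R] (A ⊗[R] H) ⊗[R] H)

end Crossed

/-- `A #_σ H` is a right `H`-crossed product: it is associative with unity `1 # 1`. -/
structure IsCrossedProduct (w : WeakAction R H A) (σ : H ⊗[R] H →ₗ[R] A) : Prop where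
  mul_assoc : ∀ x y z : Crossed w σ, x * y * z = x * (y * z)
  one_mul : ∀ x : Crossed w σ, Crossed.mk w σ 1 1 * x = x
  mul_one : ∀ x : Crossed w σ, x * Crossed.mk w σ 1 1 = x

/-- `τ` is the inverse of `σ` in the convolution algebra `Hom_R(H ⊗ H, A)`. -/
def IsConvInverse (σ τ : H ⊗[R] H →ₗ[R] A) : Prop :=
  toConv σ * toConv τ = 1 ∧ toConv τ * toConv σ = 1

/-! ### Compatible pairs -/

/-- `φ(h ⊗ a)(k) = ∑ (Sb(k₂) a) σ(Sb(k₁) ⊗ h)`. -/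
def phiMap (w : WeakAction R H A) (σ : H ⊗[R] H →ₗ[R] A) (Sb : H →ₗ[R] H) :
    H ⊗[R] A →ₗ[R] (H →ₗ[R] A) :=
  TensorProduct.lift
    (LinearMap.mk₂ R
      (fun (h : H) (a : A) =>
        TensorProduct.lift
          (LinearMap.mk₂ R (fun (x y : H) => w.act (Sb y) a * σ (Sb x ⊗ₜ[R] h))
            (fun _ _ _ => by simp [TensorProduct.add_tmul, mul_add])
            (fun _ _ _ => by simp [← TensorProduct.smul_tmul'])
            (fun _ _ _ => by simp [add_mul])
            (fun _ _ _ => by simp)) ∘ₗ comul)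
      (fun _ _ _ => by
        rw [← LinearMap.add_comp]; congr 1; ext; simp [TensorProduct.tmul_add, mul_add])
      (fun _ _ _ => by rw [← LinearMap.smul_comp]; congr 1; ext; simp)
      (fun _ _ _ => by rw [← LinearMap.add_comp]; congr 1; ext; simp [add_mul])
      (fun _ _ _ => by rw [← LinearMap.smul_comp]; congr 1; ext; simp))

/-- For fixed `h`, `a`, `x`, the map
`y ↦ ∑ τ(y₂ ⊗ Sb(y₁)) (y₃ a) σ(y₄ ⊗ Sb(x) h)`, a convolution product of three maps `H → A`. -/
def psiAux (w : WeakAction R H A) (σ τ : H ⊗[R] H →ₗ[R] A) (Sb : H →ₗ[R] H) (h : H) (a : A)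
    (x : H) : WithConv (H →ₗ[R] A) :=
  toConv (τ ∘ₗ Sb.lTensor H ∘ₗ (TensorProduct.comm R H H).toLinearMap ∘ₗ comul) *
    toConv (w.act.flip a) * toConv ((TensorProduct.curry σ).flip (Sb x * h))

/-- `ψ(h ⊗ a)(k) = ∑ τ(k₃ ⊗ Sb(k₂)) (k₄ a) σ(k₅ ⊗ Sb(k₁) h)`, where `τ` is the convolution
inverse of `σ`. -/
def psiMap (w : WeakAction R H A) (σ τ : H ⊗[R] H →ₗ[R] A) (Sb : H →ₗ[R] H) :
    H ⊗[R] A →ₗ[R] (H →ₗ[R] A) :=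
  TensorProduct.lift
    (LinearMap.mk₂ R
      (fun (h : H) (a : A) =>
        TensorProduct.lift
          (LinearMap.mk₂ R (fun (x y : H) => (psiAux w σ τ Sb h a x).ofConv y)
            (fun _ _ _ => by simp only [psiAux, map_add, add_mul, toConv_add, mul_add]; rfl)
            (fun _ _ _ => by
              simp only [psiAux, map_smul, smul_mul_assoc, toConv_smul, mul_smul_comm]; rfl)
            (fun _ _ _ => by simp only [map_add])
            (fun _ _ _ => by simp only [map_smul])) ∘ₗ comul)
      (fun _ _ _ => by
        rw [← LinearMap.add_comp]; congr 1; ext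
        simp only [psiAux, mul_add, map_add, toConv_add]; rfl)
      (fun _ _ _ => by
        rw [← LinearMap.smul_comp]; congr 1; ext
        simp only [psiAux, mul_smul_comm, map_smul, toConv_smul]; rfl)
      (fun _ _ _ => by
        rw [← LinearMap.add_comp]; congr 1; ext
        simp only [psiAux, mul_add, add_mul, map_add, toConv_add]; rfl)
      (fun _ _ _ => by
        rw [← LinearMap.smul_comp]; congr 1; ext
        simp only [psiAux, mul_smul_comm, smul_mul_assoc, map_smul, toConv_smul]; rfl))

/-- The pair `(V, U)` is compatible: the images of `φ` and `ψ` are contained in the image of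
`J : A ⊗ V → Hom_R(H, A)`, `a ⊗ v ↦ [h ↦ v(h) a]`, and `(V, U)` satisfies the RL-condition. -/
structure IsCompatible (w : WeakAction R H A) (σ τ : H ⊗[R] H →ₗ[R] A) (Sb : H →ₗ[R] H)
    (V : Submodule R (Module.Dual R H)) (U : RightModuleSubalgebra R H) : Prop where
  phi_le : LinearMap.range (phiMap w σ Sb) ≤ LinearMap.range (pairingMap A V.subtype)
  psi_le : LinearMap.range (psiMap w σ τ Sb) ≤ LinearMap.range (pairingMap A V.subtype)
  rl : RLCondition V U

end Crossed

end Hopf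

end CrossedDuality

end

/-! Write B = A #_σ H and γ(h) = 1 # h. The algebra B # U acts on B by (b # f)y = b(f ⇀ y), and A ⊗
(H # U) acts on A ⊗ H (`smashEnd_mul`, `tensorEnd_mul`). The two modules are compared through the
map ν : A ⊗ H → B, a ⊗ h ↦ γ'(h)a (`normalBasis`), where γ' inverts γ ∘ Sb: ∑ γ'(k₂)γ(Sb(k₁)) =
ε(k)1 = ∑ γ(Sb(k₂))γ'(k₁) (`γt_mul_γ`, `γ_mul_γt`).

Sending x in B # U to x ∘ ν, and y in A ⊗ (H # U) to ν ∘ y, maps both algebras into Hom_R(A ⊗ H, B).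
Both maps are injective: convolving such an operator with γ ∘ Sb, respectively with Sb, gives back
the canonical map α. Once the two ranges agree, every x has a unique partner y with ν ∘ y = x ∘ ν,
and this intertwining relation makes the correspondence multiplicative and unital. Only injectivity
of ν is needed.

The ranges agree by two commutation rules. The identity a γ(h) γ'(k) = ∑ γ'(h₃k₂) φ(h₁ ⊗ a)(h₂k₁)
(`ι_mul_γ_mul_γt`) gives one inclusion, and ∑ γ'(hk₂) a γ(Sb(k₁)) = ∑ ψ(h₁ ⊗ a)(h₂k₂) γ(h₃k₃Sb(k₁))
(`sw_γt_mul_ι_mul_γ`) gives the other. Compatibility writes the values of φ and ψ as sums of v(·)a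
with v in V, and the RL-condition turns the right action of v on H into an element of H # U. -/

noncomputable section

namespace CrossedDuality

open Coalgebra WithConv

/-! ### Sweedler calculus in a coalgebra. -/

/-- Unbundled linearity of a function, in a form accessible to `fun_prop`. -/
@[fun_prop]
structure IsLin (R : Type*) {M N : Type*} [CommRing R] [AddCommGroup M] [Module R M]
    [AddCommGroup N] [Module R N] (f : M → N) : Prop where
  map_add : ∀ x y, f (x + y) = f x + f y
  map_smul : ∀ (r : R) x, f (r • x) = r • f x

/-- The Sweedler sum `∑ F(h₁, h₂)`. -/
def sw (R : Type*) {C X : Type*} [CommRing R] [AddCommGroup C] [Module R C] [CoalgebraStruct R C]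
    [AddCommGroup X] (F : C → C → X) (h : C) : X :=
  ∑ p ∈ (ℛ R h).index, F ((ℛ R h).left p) ((ℛ R h).right p)

namespace IsLin

variable {R M N P : Type*} [CommRing R] [AddCommGroup M] [Module R M]
    [AddCommGroup N] [Module R N] [AddCommGroup P] [Module R P]

@[fun_prop]
theorem id : IsLin R (fun x : M => x) := ⟨fun _ _ => rfl, fun _ _ => rfl⟩

@[fun_prop]
theorem comp {f : N → P} {g : M → N} (hf : IsLin R f) (hg : IsLin R g) :
    IsLin R (fun x => f (g x)) :=
  ⟨fun x y => by rw [hg.map_add, hf.map_add], fun r x => by rw [hg.map_smul, hf.map_smul]⟩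

@[fun_prop]
theorem linearMap (f : M →ₗ[R] N) : IsLin R (fun x => f x) := ⟨f.map_add, f.map_smul⟩

@[fun_prop]
theorem linearEquiv (f : M ≃ₗ[R] N) : IsLin R (fun x => f x) := ⟨f.map_add, f.map_smul⟩

@[fun_prop]
theorem algHom {A B : Type*} [Ring A] [Ring B] [Algebra R A] [Algebra R B] (f : A →ₐ[R] B) :
    IsLin R (fun x => f x) := ⟨_root_.map_add f, _root_.map_smul f⟩

@[fun_prop]
theorem linearMap_apply {f : M → N →ₗ[R] P} (n : N) (hf : IsLin R f) : IsLin R (fun x => f x n) :=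
  ⟨fun x y => by rw [hf.map_add]; rfl, fun r x => by rw [hf.map_smul]; rfl⟩

@[fun_prop]
theorem add {f g : M → N} (hf : IsLin R f) (hg : IsLin R g) : IsLin R (fun x => f x + g x) :=
  ⟨fun x y => by rw [hf.map_add, hg.map_add]; abel,
    fun r x => by rw [hf.map_smul, hg.map_smul, smul_add]⟩

@[fun_prop]
theorem mul_const {A : Type*} [Ring A] [Algebra R A] {f : M → A} (a : A) (hf : IsLin R f) :
    IsLin R (fun x => f x * a) :=
  ⟨fun x y => by rw [hf.map_add, add_mul], fun r x => by rw [hf.map_smul, smul_mul_assoc]⟩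

@[fun_prop]
theorem const_mul {A : Type*} [Ring A] [Algebra R A] {f : M → A} (a : A) (hf : IsLin R f) :
    IsLin R (fun x => a * f x) :=
  ⟨fun x y => by rw [hf.map_add, mul_add], fun r x => by rw [hf.map_smul, mul_smul_comm]⟩

@[fun_prop]
theorem smul_const {f : M → R} (n : N) (hf : IsLin R f) : IsLin R (fun x => f x • n) :=
  ⟨fun x y => by rw [hf.map_add, add_smul], fun r x => by rw [hf.map_smul, smul_assoc]⟩

@[fun_prop]
theorem const_smul {f : M → N} (r : R) (hf : IsLin R f) : IsLin R (fun x => r • f x) :=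
  ⟨fun x y => by rw [hf.map_add, smul_add], fun s x => by rw [hf.map_smul, smul_comm]⟩

@[fun_prop]
theorem tmul_const {f : M → N} (n : P) (hf : IsLin R f) : IsLin R (fun x => f x ⊗ₜ[R] n) :=
  ⟨fun x y => by rw [hf.map_add, TensorProduct.add_tmul],
    fun r x => by rw [hf.map_smul, TensorProduct.smul_tmul']⟩

@[fun_prop]
theorem const_tmul {f : M → N} (n : P) (hf : IsLin R f) : IsLin R (fun x => n ⊗ₜ[R] f x) :=
  ⟨fun x y => by rw [hf.map_add, TensorProduct.tmul_add],
    fun r x => by rw [hf.map_smul, TensorProduct.tmul_smul]⟩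

variable {C : Type*} [AddCommGroup C] [Module R C] [CoalgebraStruct R C]

@[fun_prop]
theorem sw_const {F : M → C → C → N} (h : C) (hF : ∀ x y, IsLin R (fun m => F m x y)) :
    IsLin R (fun m => sw R (F m) h) :=
  ⟨fun x y => by simp only [sw, (hF _ _).map_add, Finset.sum_add_distrib],
    fun r x => by simp only [sw, (hF _ _).map_smul, Finset.smul_sum]⟩

/-- A function with linear dependence, as a bundled linear map. -/
@[simps] def toLinearMap {f : M → N} (hf : IsLin R f) : M →ₗ[R] N := ⟨⟨f, hf.map_add⟩, hf.map_smul⟩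

theorem map_sum {f : M → N} (hf : IsLin R f) {ι : Type*} (s : Finset ι) (g : ι → M) :
    f (∑ i ∈ s, g i) = ∑ i ∈ s, f (g i) := _root_.map_sum hf.toLinearMap g s

end IsLin

section

variable {R M N P : Type*} [CommRing R] [AddCommGroup M] [Module R M]
    [AddCommGroup N] [Module R N] [AddCommGroup P] [Module R P]
  {C : Type*} [AddCommGroup C] [Module R C] [Coalgebra R C]

/-- The linear map on a tensor product induced by a function linear in each variable. -/
def lift₂ (F : M → N → P) (h₁ : ∀ y, IsLin R (fun x => F x y)) (h₂ : ∀ x, IsLin R (fun y => F x y)) :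
    M ⊗[R] N →ₗ[R] P :=
  TensorProduct.lift (LinearMap.mk₂ R F (fun a b c => (h₁ c).map_add a b)
    (fun r a c => (h₁ c).map_smul r a) (fun a b c => (h₂ a).map_add b c)
    (fun r a c => (h₂ a).map_smul r c))

@[simp]
theorem lift₂_tmul (F : M → N → P) (h₁ : ∀ y, IsLin R (fun x => F x y))
    (h₂ : ∀ x, IsLin R (fun y => F x y)) (m : M) (n : N) : lift₂ F h₁ h₂ (m ⊗ₜ n) = F m n := rfl

/-- `sw` sums over a chosen representative of Δ(h). Bilinearity of the summand makes the value
depend on Δ(h) only, and every identity of Sweedler sums that is not mere rearrangement rests on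
this. -/
theorem sw_eq (F : C → C → P) (h₁ : ∀ y, IsLin R (fun x => F x y))
    (h₂ : ∀ x, IsLin R (fun y => F x y)) (h : C) : sw R F h = lift₂ F h₁ h₂ (comul h) := by
  simp [← (ℛ R h).eq, sw]

@[fun_prop]
theorem IsLin.sw_arg {F : C → C → P} {g : M → C} (h₁ : ∀ y, IsLin R (fun x => F x y))
    (h₂ : ∀ x, IsLin R (fun y => F x y)) (hg : IsLin R g) : IsLin R (fun m => sw R F (g m)) := by
  simp only [sw_eq F h₁ h₂]; fun_prop

/-- Coassociativity, oriented as a rewriting rule towards right-nested sums; together with `sw_comm`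
it normalises the long Sweedler expressions below. -/
theorem sw_assoc (F : C → C → C → P) (h₁ : ∀ y z, IsLin R (fun x => F x y z))
    (h₂ : ∀ x z, IsLin R (fun y => F x y z)) (h₃ : ∀ x y, IsLin R (fun z => F x y z)) (h : C) :
    sw R (fun x z => sw R (fun x y => F x y z) x) h =
      sw R (fun x y => sw R (fun y z => F x y z) y) h := by
  have hlin : ∀ y : C ⊗[R] C, IsLin R (fun x => lift₂ (F x) (h₂ x) (h₃ x) y) := fun y => by
    induction y using TensorProduct.induction_on with
    | zero => simpa using (⟨by simp, by simp⟩ : IsLin R (fun _ : C => (0 : P)))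
    | tmul a b => simpa using h₁ a b
    | add a b ha hb => simpa using ha.add hb
  have key := congrArg (lift₂ (fun x (y : C ⊗[R] C) => lift₂ (F x) (h₂ x) (h₃ x) y) hlin
    (fun x => by fun_prop)) (coassoc_apply (R := R) h)
  simp_rw [sw_eq (F _) (h₂ _) (h₃ _)]
  rw [sw_eq _ (by fun_prop) (by fun_prop), sw]
  rw [← (ℛ R h).eq] at key ⊢
  simp only [map_sum, LinearMap.rTensor_tmul, LinearMap.lTensor_tmul, lift₂_tmul] at key ⊢
  rw [← key]
  refine Finset.sum_congr rfl fun i _ => ?_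
  rw [← (ℛ R ((ℛ R h).left i)).eq, sw]
  simp [TensorProduct.sum_tmul]

theorem sw_counit_left (F : C → P) (hF : IsLin R F) (h : C) :
    sw R (fun x y => counit (R := R) x • F y) h = F h := by
  rw [sw_eq _ (by fun_prop) (by fun_prop)]
  have := congrArg (lift₂ (fun (r : R) y => r • F y) (by fun_prop) (by fun_prop))
    (rTensor_counit_comul (R := R) h)
  rw [lift₂_tmul, one_smul] at this
  refine Eq.trans ?_ this
  rw [← (ℛ R h).eq]
  simp only [map_sum, lift₂_tmul, LinearMap.rTensor_tmul]

theorem sw_counit_right (F : C → P) (hF : IsLin R F) (h : C) :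
    sw R (fun x y => counit (R := R) y • F x) h = F h := by
  rw [sw_eq _ (by fun_prop) (by fun_prop)]
  have := congrArg (lift₂ (fun y (r : R) => r • F y) (by fun_prop) (by fun_prop))
    (lTensor_counit_comul (R := R) h)
  rw [lift₂_tmul, one_smul] at this
  refine Eq.trans ?_ this
  rw [← (ℛ R h).eq]
  simp only [map_sum, lift₂_tmul, LinearMap.lTensor_tmul]

theorem comul_eq_sw (h : C) : comul h = sw R (fun x y => x ⊗ₜ[R] y) h := (ℛ R h).eq.symm

theorem map_sw {f : M → N} (hf : IsLin R f) (F : C → C → M) (h : C) :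
    f (sw R F h) = sw R (fun x y => f (F x y)) h := hf.map_sum _ _

theorem sw_congr {X : Type*} [AddCommGroup X] {F G : C → C → X} {h : C}
    (H : ∀ x y, F x y = G x y) : sw R F h = sw R G h := Finset.sum_congr rfl fun _ _ => H _ _

theorem sw_comm {D : Type*} [AddCommGroup D] [Module R D] [CoalgebraStruct R D]
    {X : Type*} [AddCommGroup X] (F : C → C → D → D → X) (h : C) (k : D) :
    sw R (fun a b => sw R (fun c d => F a b c d) k) h =
      sw R (fun c d => sw R (fun a b => F a b c d) h) k := Finset.sum_comm

theorem mul_sw {A : Type*} [Ring A] [Algebra R A] (a : A) (F : C → C → A) (h : C) :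
    a * sw R F h = sw R (fun x y => a * F x y) h := Finset.mul_sum ..

theorem sw_mul_const {A : Type*} [Ring A] [Algebra R A] (a : A) (F : C → C → A) (h : C) :
    sw R F h * a = sw R (fun x y => F x y * a) h := Finset.sum_mul ..

theorem smul_sw (r : R) (F : C → C → P) (h : C) :
    r • sw R F h = sw R (fun x y => r • F x y) h := Finset.smul_sum

theorem tmul_sw (m : M) (F : C → C → P) (h : C) :
    m ⊗ₜ[R] sw R F h = sw R (fun x y => m ⊗ₜ[R] F x y) h := TensorProduct.tmul_sum ..

theorem sw_tmul (m : M) (F : C → C → P) (h : C) :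
    sw R F h ⊗ₜ[R] m = sw R (fun x y => F x y ⊗ₜ[R] m) h := TensorProduct.sum_tmul ..

end

/-! ### Sweedler calculus in a bialgebra and convolution. -/

section

variable {R H P : Type*} [CommRing R] [Ring H] [Bialgebra R H] [AddCommGroup P] [Module R P]

@[fun_prop]
theorem IsLin.counit : IsLin R (fun h : H => counit (R := R) h) := IsLin.linearMap _

theorem sw_one (F : H → H → P) (h₁ : ∀ y, IsLin R (fun x => F x y))
    (h₂ : ∀ x, IsLin R (fun y => F x y)) : sw R F (1 : H) = F 1 1 := by
  rw [sw_eq _ h₁ h₂, Bialgebra.comul_one, Algebra.TensorProduct.one_def, lift₂_tmul]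

theorem sw_mul (F : H → H → P) (h₁ : ∀ y, IsLin R (fun x => F x y))
    (h₂ : ∀ x, IsLin R (fun y => F x y)) (h k : H) :
    sw R F (h * k) = sw R (fun a b => sw R (fun c d => F (a * c) (b * d)) k) h := by
  rw [sw_eq _ h₁ h₂, Bialgebra.comul_mul, ← (ℛ R h).eq, ← (ℛ R k).eq]
  simp [sw, Finset.sum_mul_sum]

theorem rightHit_apply (f : Module.Dual R H) (k : H) :
    rightHit f k = sw R (fun x y => f x • y) k := by
  simp [rightHit, sw, ← (ℛ R k).eq]

theorem conv_mul_apply {C A : Type*} [AddCommGroup C] [Module R C] [Coalgebra R C] [Ring A]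
    [Algebra R A] (f g : WithConv (C →ₗ[R] A)) (c : C) :
    (f * g) c = sw R (fun x y => f x * g y) c := by
  rw [(ℛ R c).convMul_apply]; rfl

theorem sw_tensor (F : H ⊗[R] H → H ⊗[R] H → P) (h₁ : ∀ y, IsLin R (fun x => F x y))
    (h₂ : ∀ x, IsLin R (fun y => F x y)) (h k : H) :
    sw R F (h ⊗ₜ[R] k) =
      sw R (fun a b => sw R (fun c d => F (a ⊗ₜ c) (b ⊗ₜ d)) k) h := by
  rw [sw_eq _ h₁ h₂, TensorProduct.comul_tmul, ← (ℛ R h).eq, ← (ℛ R k).eq]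
  simp only [sw, TensorProduct.tmul_sum, TensorProduct.sum_tmul, map_sum,
    TensorProduct.AlgebraTensorModule.tensorTensorTensorComm_tmul, lift₂_tmul]
  exact Finset.sum_comm

variable {A : Type*} [Ring A] [Algebra R A]

theorem IsConvInverse.mul_apply {σ τ : H ⊗[R] H →ₗ[R] A} (hτ : IsConvInverse σ τ) (h k : H) :
    sw R (fun a b => sw R (fun c d => τ (a ⊗ₜ c) * σ (b ⊗ₜ d)) k) h =
      (counit (R := R) h * counit (R := R) k) • (1 : A) := by
  have := congrArg (fun f => f.ofConv (h ⊗ₜ[R] k)) hτ.2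
  simp only [conv_mul_apply] at this
  rw [sw_tensor _ (by fun_prop) (by fun_prop)] at this
  refine this.trans ?_
  simp [LinearMap.convOne_def, Algebra.algebraMap_eq_smul_one, mul_comm]

theorem WeakAction.act_one (w : WeakAction R H A) (h : H) :
    w.act h 1 = counit (R := R) h • (1 : A) := by
  have := congrArg (fun f => f.ofConv h) w.flip_one
  simpa [Algebra.algebraMap_eq_smul_one] using this

end

/-! ### Properties of the twisted antipode. -/

namespace IsTwistedAntipode

variable {R H P : Type*} [CommRing R] [Ring H] [Bialgebra R H] [AddCommGroup P] [Module R P]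
  {Sb : H →ₗ[R] H}

theorem sw_mul_twist (hSb : IsTwistedAntipode Sb) (F : H → P) (hF : IsLin R F) (h : H) :
    sw R (fun x y => F (y * Sb x)) h = counit (R := R) h • F 1 := by
  have := LinearMap.congr_fun hSb.mul_antipode h
  simp only [LinearMap.comp_apply, ← (ℛ R h).eq, map_sum] at this
  rw [← hF.map_smul, ← Algebra.algebraMap_eq_smul_one]
  simp only [sw, ← hF.map_sum]
  simpa using congrArg F this

theorem sw_twist_mul (hSb : IsTwistedAntipode Sb) (F : H → P) (hF : IsLin R F) (h : H) :
    sw R (fun x y => F (Sb y * x)) h = counit (R := R) h • F 1 := by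
  have := LinearMap.congr_fun hSb.antipode_mul h
  simp only [LinearMap.comp_apply, ← (ℛ R h).eq, map_sum] at this
  rw [← hF.map_smul, ← Algebra.algebraMap_eq_smul_one]
  simp only [sw, ← hF.map_sum]
  simpa using congrArg F this

/-- `∑ F(h₂ Sb(h₁), h₃) = F(1, h)`. -/
theorem sw_sw_mul_twist (hSb : IsTwistedAntipode Sb) (F : H → H → P)
    (h₁ : ∀ y, IsLin R (fun x => F x y)) (h₂ : ∀ x, IsLin R (fun y => F x y)) (h : H) :
    sw R (fun x y => sw R (fun y z => F (y * Sb x) z) y) h = F 1 h := by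
  rw [← sw_assoc (fun x y z => F (y * Sb x) z) (by fun_prop) (by fun_prop) (by fun_prop)]
  simp_rw [hSb.sw_mul_twist (fun x => F x _) (h₁ _)]
  exact sw_counit_left (F 1) (h₂ 1) h

/-- `∑ F(Sb(h₂) h₁, h₃) = F(1, h)`. -/
theorem sw_sw_twist_mul (hSb : IsTwistedAntipode Sb) (F : H → H → P)
    (h₁ : ∀ y, IsLin R (fun x => F x y)) (h₂ : ∀ x, IsLin R (fun y => F x y)) (h : H) :
    sw R (fun x y => sw R (fun y z => F (Sb y * x) z) y) h = F 1 h := by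
  rw [← sw_assoc (fun x y z => F (Sb y * x) z) (by fun_prop) (by fun_prop) (by fun_prop)]
  simp_rw [hSb.sw_twist_mul (fun x => F x _) (h₁ _)]
  exact sw_counit_left (F 1) (h₂ 1) h

/-- `∑ F(h₁, Sb(h₃) h₂) = F(h, 1)`. -/
theorem sw_twist_mul_right (hSb : IsTwistedAntipode Sb) (F : H → H → P)
    (h₁ : ∀ y, IsLin R (fun x => F x y)) (h₂ : ∀ x, IsLin R (fun y => F x y)) (h : H) :
    sw R (fun x y => sw R (fun y z => F x (Sb z * y)) y) h = F h 1 := by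
  simp_rw [hSb.sw_twist_mul (fun x => F _ x) (h₂ _)]
  exact sw_counit_right (fun x => F x 1) (h₁ 1) h

theorem counit_apply (hSb : IsTwistedAntipode Sb) (h : H) :
    counit (R := R) (Sb h) = counit (R := R) h := by
  have := hSb.sw_mul_twist (fun x => counit (R := R) x) (by fun_prop) h
  simp only [Bialgebra.counit_mul] at this
  simp only [← smul_eq_mul (α := R)] at this
  rw [sw_counit_right (fun x => counit (R := R) (Sb x)) (by fun_prop)] at this
  simpa using this

/-- Uniqueness of convolution inverses: ∑ Sb(h₃k₃) h₂k₂ Sb(k₁)Sb(h₁) is evaluated twice, cancelling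
either its left or its right part. -/
theorem map_mul (hSb : IsTwistedAntipode Sb) (h k : H) : Sb (h * k) = Sb k * Sb h := by
  have e₁ : sw R (fun x y => sw R (fun y z => sw R (fun a b => sw R (fun b c =>
      Sb (z * c) * (y * b) * (Sb a * Sb x)) b) k) y) h = Sb k * Sb h := by
    have e (x y : H) : sw R (fun y z => sw R (fun a b => sw R (fun b c =>
        Sb (z * c) * (y * b) * (Sb a * Sb x)) b) k) y =
        sw R (fun a b => sw R (fun u v => Sb v * u * (Sb a * Sb x)) (y * b)) k := by
      refine (sw_comm _ _ _).trans (congrArg (fun F => sw R F k) ?_)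
      funext a b
      exact (sw_mul (fun u v => Sb v * u * (Sb a * Sb x)) (by fun_prop) (by fun_prop) _ _).symm
    simp_rw [e]
    simp_rw [fun p q => hSb.sw_twist_mul (fun u => u * (Sb p * Sb q)) (by fun_prop),
      Bialgebra.counit_mul, mul_smul, one_mul, ← smul_sw,
      fun q => sw_counit_right (R := R) (fun a => Sb a * Sb q) (by fun_prop)]
    exact sw_counit_right (fun a => Sb k * Sb a) (by fun_prop) h
  have e₂ : sw R (fun x y => sw R (fun y z => sw R (fun a b => sw R (fun b c =>
      Sb (z * c) * (y * b) * (Sb a * Sb x)) b) k) y) h = Sb (h * k) := by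
    have : ∀ x y z a b c, Sb (z * c) * (y * b) * (Sb a * Sb x) =
      Sb (z * c) * (y * (b * Sb a) * Sb x) := fun _ _ _ _ _ _ => by noncomm_ring
    simp_rw [this, fun x y z => hSb.sw_sw_mul_twist (fun u c => Sb (z * c) * (y * u * Sb x))
      (by fun_prop) (by fun_prop), mul_one]
    rw [hSb.sw_sw_mul_twist (fun u z => Sb (z * k) * u) (by fun_prop) (by fun_prop), mul_one]
  rw [← e₁, e₂]

/-- Says that Sb reverses the coproduct. Both Δ(Sb(h)) and ∑ Sb(h₂) ⊗ Sb(h₁) invert Δ, so ∑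
Δ(Sb(h₃)) Δ(h₂) (∑ Sb(b) ⊗ Sb(a)), with a ⊗ b running over Δ(h₁), is evaluated in two ways. -/
theorem sw_apply (hSb : IsTwistedAntipode Sb) (F : H → H → P)
    (h₁ : ∀ y, IsLin R (fun x => F x y)) (h₂ : ∀ x, IsLin R (fun y => F x y)) (h : H) :
    sw R F (Sb h) = sw R (fun x y => F (Sb y) (Sb x)) h := by
  have e₀ (h : H) : sw R (fun x y => comul (R := R) y * sw R (fun a b => Sb b ⊗ₜ[R] Sb a) x) h =
      counit (R := R) h • 1 := by
    simp_rw [comul_eq_sw (R := R), mul_sw, sw_mul_const, Algebra.TensorProduct.tmul_mul_tmul]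
    rw [sw_assoc (fun a b y => sw R (fun c d => (c * Sb b) ⊗ₜ[R] (d * Sb a)) y) (by fun_prop)
      (by fun_prop) (by fun_prop)]
    simp_rw [fun a => hSb.sw_sw_mul_twist (fun u d => u ⊗ₜ[R] (d * Sb a)) (by fun_prop) (by fun_prop)]
    exact hSb.sw_mul_twist (fun u => 1 ⊗ₜ[R] u) (by fun_prop) h
  have e₁ : sw R (fun x y => sw R (fun y z => comul (R := R) (Sb z) * (comul (R := R) y *
      sw R (fun a b => Sb b ⊗ₜ[R] Sb a) x)) y) h = sw R (fun a b => Sb b ⊗ₜ[R] Sb a) h := by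
    simp_rw [← mul_assoc, ← Bialgebra.comul_mul]
    rw [hSb.sw_twist_mul_right (fun x u => comul (R := R) u * sw R (fun a b => Sb b ⊗ₜ[R] Sb a) x)
      (by fun_prop) (by fun_prop), Bialgebra.comul_one, one_mul]
  have e₂ : sw R (fun x y => sw R (fun y z => comul (R := R) (Sb z) * (comul (R := R) y *
      sw R (fun a b => Sb b ⊗ₜ[R] Sb a) x)) y) h = comul (R := R) (Sb h) := by
    rw [← sw_assoc (fun x y z => comul (R := R) (Sb z) * (comul (R := R) y *
      sw R (fun a b => Sb b ⊗ₜ[R] Sb a) x)) (by fun_prop) (by fun_prop) (by fun_prop)]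
    simp_rw [← mul_sw, e₀, mul_smul_comm, mul_one]
    exact sw_counit_left (fun z => comul (R := R) (Sb z)) (by fun_prop) h
  rw [sw_eq F h₁ h₂, ← e₂, e₁, map_sw (IsLin.linearMap _)]
  rfl

end IsTwistedAntipode

/-! ### Presentations of crossed products and the maps φ, ψ. -/

/-- A presentation of an `R`-algebra `B` with a map `δ : B → B ⊗ H` as a crossed product of `A`
with `H`: `B` is free over `A` on the image of `γ : H → B`, with the multiplication and the
coaction of `A #_σ H`. -/
structure CrossedPresentation {R H A B : Type*} [CommRing R] [Ring H] [Bialgebra R H] [Ring A]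
    [Algebra R A] [Ring B] [Algebra R B] (w : WeakAction R H A) (σ : H ⊗[R] H →ₗ[R] A)
    (δ : B →ₗ[R] B ⊗[R] H) where
  ι : A →ₐ[R] B
  γ : H →ₗ[R] B
  -- For A #_σ H this is id ⊗ ε. Uniqueness of coordinates enters only through this projection.
  p : B →ₗ[R] A
  exists_rep : ∀ b : B, ∃ x : A ⊗[R] H,
    TensorProduct.lift ((LinearMap.mul R B).compl₁₂ ι.toLinearMap γ) x = b
  p_apply : ∀ a h, p (ι a * γ h) = counit (R := R) h • a
  γ_one : γ 1 = 1
  γ_mul_ι : ∀ h a, γ h * ι a = sw R (fun x y => ι (w.act x a) * γ y) h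
  γ_mul_γ : ∀ h k, γ h * γ k =
    sw R (fun a b => sw R (fun c d => ι (σ (a ⊗ₜ c)) * γ (b * d)) k) h
  δ_apply : ∀ a h, δ (ι a * γ h) = sw R (fun x y => (ι a * γ x) ⊗ₜ y) h

section

variable {R H A : Type*} [CommRing R] [Ring H] [Bialgebra R H] [Ring A] [Algebra R A]

theorem phiMap_apply (w : WeakAction R H A) (σ : H ⊗[R] H →ₗ[R] A) (Sb : H →ₗ[R] H) (h : H)
    (a : A) (k : H) : phiMap w σ Sb (h ⊗ₜ a) k =
      sw R (fun x y => w.act (Sb y) a * σ (Sb x ⊗ₜ[R] h)) k := by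
  simp [phiMap, sw, ← (ℛ R k).eq]

/-- `k ↦ ∑ τ(k₂ ⊗ Sb(k₁))`. -/
def twistedCocycle (τ : H ⊗[R] H →ₗ[R] A) (Sb : H →ₗ[R] H) : H →ₗ[R] A :=
  τ ∘ₗ Sb.lTensor H ∘ₗ (TensorProduct.comm R H H).toLinearMap ∘ₗ comul

theorem twistedCocycle_apply (τ : H ⊗[R] H →ₗ[R] A) (Sb : H →ₗ[R] H) (k : H) :
    twistedCocycle τ Sb k = sw R (fun x y => τ (y ⊗ₜ[R] Sb x)) k := by
  simp [twistedCocycle, sw, ← (ℛ R k).eq]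

/-- `y ⊗ z ↦ ∑ τ(y₂ ⊗ Sb(y₁)) (y₃ a) σ(y₄ ⊗ z)`. -/
def psiCore (w : WeakAction R H A) (σ τ : H ⊗[R] H →ₗ[R] A) (Sb : H →ₗ[R] H) (a : A) :
    H →ₗ[R] H →ₗ[R] A :=
  (IsLin.toLinearMap (R := R)
    (f := fun z => (toConv (twistedCocycle τ Sb) *
      (toConv (w.act.flip a) * toConv ((TensorProduct.curry σ).flip z))).ofConv)
    ⟨fun _ _ => by simp only [map_add, toConv_add, mul_add, ofConv_add],
      fun _ _ => by simp only [map_smul, toConv_smul, mul_smul_comm, ofConv_smul]⟩).flip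

theorem psiCore_apply (w : WeakAction R H A) (σ τ : H ⊗[R] H →ₗ[R] A) (Sb : H →ₗ[R] H) (a : A)
    (y z : H) : psiCore w σ τ Sb a y z =
      sw R (fun c v => sw R (fun d e => twistedCocycle τ Sb c * (w.act d a * σ (e ⊗ₜ z))) v) y := by
  have h₁ := conv_mul_apply (toConv (twistedCocycle τ Sb))
    (toConv (w.act.flip a) * toConv ((TensorProduct.curry σ).flip z)) y
  have h₂ := conv_mul_apply (toConv (w.act.flip a)) (toConv ((TensorProduct.curry σ).flip z))
  simp_rw [← mul_sw]
  refine h₁.trans (sw_congr fun c v => ?_)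
  rw [h₂]
  rfl

theorem psiMap_apply (w : WeakAction R H A) (σ τ : H ⊗[R] H →ₗ[R] A) (Sb : H →ₗ[R] H) (h : H)
    (a : A) (k : H) : psiMap w σ τ Sb (h ⊗ₜ a) k =
      sw R (fun x y => psiCore w σ τ Sb a y (Sb x * h)) k := by
  have : ∀ x y, (psiAux w σ τ Sb h a x).ofConv y = psiCore w σ τ Sb a y (Sb x * h) := fun x y => by
    rw [psiAux, mul_assoc]; rfl
  rw [psiMap, TensorProduct.lift.tmul, LinearMap.mk₂_apply, LinearMap.comp_apply, ← (ℛ R k).eq,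
    map_sum]
  refine Finset.sum_congr rfl fun i _ => ?_
  rw [TensorProduct.lift.tmul, LinearMap.mk₂_apply, this]

/-- On the left the second argument of the core is Sb(h₂k₁)h₁ = Sb(k₁)Sb(h₂)h₁, and Sb(h₂)h₁
cancels. -/
theorem psiMap_twist {w : WeakAction R H A} {σ τ : H ⊗[R] H →ₗ[R] A} {Sb : H →ₗ[R] H}
    (hSb : IsTwistedAntipode Sb) (a : A) (h k : H) :
    sw R (fun x y => psiMap w σ τ Sb (x ⊗ₜ a) (y * k)) h =
      sw R (fun x y => psiCore w σ τ Sb a (h * y) (Sb x)) k := by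
  simp (disch := fun_prop) only [psiMap_apply, sw_mul, hSb.map_mul, mul_assoc]
  rw [hSb.sw_sw_twist_mul (fun u v => sw R (fun c d =>
    psiCore w σ τ Sb a (v * d) (Sb c * u)) k) (by fun_prop) (by fun_prop)]
  simp_rw [mul_one]

end

/-! ### The inverse γ' of γ ∘ Sb and the two commutation rules. -/

namespace CrossedPresentation

variable {R H A B : Type*} [CommRing R] [Ring H] [Bialgebra R H] [Ring A]
    [Algebra R A] [Ring B] [Algebra R B] {w : WeakAction R H A} {σ τ : H ⊗[R] H →ₗ[R] A}
    {δ : B →ₗ[R] B ⊗[R] H} (E : CrossedPresentation w σ δ) {Sb : H →ₗ[R] H}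

/-- `k ↦ ∑ τ(k₂ ⊗ Sb(k₁)) γ(k₃)`, the inverse of `γ ∘ Sb` for the opposite convolution. -/
def γt (τ : H ⊗[R] H →ₗ[R] A) (Sb : H →ₗ[R] H) : H →ₗ[R] B :=
  IsLin.toLinearMap (R := R)
    (f := fun k => sw R (fun x y => E.ι (twistedCocycle τ Sb x) * E.γ y) k) (by fun_prop)

theorem γt_eq (k : H) : E.γt τ Sb k = sw R (fun x y => E.ι (twistedCocycle τ Sb x) * E.γ y) k := rfl

theorem γt_apply (k : H) : E.γt τ Sb k =
    sw R (fun x y => sw R (fun y z => E.ι (τ (y ⊗ₜ Sb x)) * E.γ z) y) k := by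
  simp_rw [γt_eq, twistedCocycle_apply, map_sw (IsLin.algHom E.ι), sw_mul_const]
  exact sw_assoc (fun x y z => E.ι (τ (y ⊗ₜ Sb x)) * E.γ z) (by fun_prop) (by fun_prop)
    (by fun_prop) k

/-- The rule γ(y)γ(z) = ∑ σ(y₁ ⊗ z₁)γ(y₂z₂) solved for γ(yz), by inserting τ ⋆ σ = ε ⊗ ε. -/
theorem τ_mul_γ_mul_γ (hτ : IsConvInverse σ τ) (y z : H) :
    sw R (fun a b => sw R (fun c d => E.ι (τ (a ⊗ₜ c)) * (E.γ b * E.γ d)) z) y = E.γ (y * z) := by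
  have e : E.γ (y * z) = sw R (fun a b => sw R (fun c d =>
      E.ι ((counit (R := R) a * counit (R := R) c) • 1) * E.γ (b * d)) z) y := by
    simp_rw [map_smul, map_one, smul_mul_assoc, one_mul, mul_smul, ← smul_sw,
      fun b => sw_counit_left (R := R) (fun d => E.γ (b * d)) (by fun_prop)]
    exact (sw_counit_left (R := R) (fun b => E.γ (b * z)) (by fun_prop) y).symm
  rw [e]
  simp_rw [← hτ.mul_apply, map_sw (IsLin.algHom E.ι), sw_mul_const, map_mul]
  refine Eq.trans ?_ (sw_congr fun a b => sw_comm _ _ _).symm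
  simp (disch := fun_prop) only [sw_assoc, E.γ_mul_γ, mul_sw, mul_assoc]
  exact sw_congr fun a b => sw_comm _ _ _

/-- Apply γ to ∑ k₂Sb(k₁) = ε(k)1 and expand by `τ_mul_γ_mul_γ`: the factors that appear are exactly
those defining γ'. -/
theorem γt_mul_γ (hSb : IsTwistedAntipode Sb) (hτ : IsConvInverse σ τ) (k : H) :
    sw R (fun x y => E.γt τ Sb y * E.γ (Sb x)) k = counit (R := R) k • 1 := by
  have h₁ (x y : H) : E.γ (y * Sb x) = sw R (fun a b => sw R (fun c d =>
      E.ι (τ (c ⊗ₜ Sb b)) * (E.γ d * E.γ (Sb a))) y) x := by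
    rw [← E.τ_mul_γ_mul_γ hτ]
    simp (disch := fun_prop) only [hSb.sw_apply]
    exact sw_comm _ _ _
  have h₂ := hSb.sw_mul_twist (fun u => E.γ u) (by fun_prop) k
  simp_rw [h₁] at h₂
  rw [sw_assoc (fun a b y => sw R (fun c d =>
      E.ι (τ (c ⊗ₜ Sb b)) * (E.γ d * E.γ (Sb a))) y) (by fun_prop) (by fun_prop) (by fun_prop),
    E.γ_one] at h₂
  rw [← h₂]
  simp_rw [γt_apply, sw_mul_const, mul_assoc]

/-- `γ(Sb(k)) a γ(h) = ∑ φ(h₁ ⊗ a)(k₂) γ(Sb(k₁) h₂)`. -/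
theorem γ_twist_mul (hSb : IsTwistedAntipode Sb) (k : H) (a : A) (h : H) :
    E.γ (Sb k) * (E.ι a * E.γ h) = sw R (fun c s => sw R (fun x y =>
      E.ι (phiMap w σ Sb (x ⊗ₜ a) s) * E.γ (Sb c * y)) h) k := by
  rw [← mul_assoc, E.γ_mul_ι]
  simp (disch := fun_prop) only [hSb.sw_apply, sw_mul_const, mul_assoc, E.γ_mul_γ, mul_sw, sw_assoc,
    phiMap_apply, map_sw (IsLin.algHom E.ι), map_mul]
  exact sw_congr fun a b => sw_comm _ _ _

/-- In `γ_twist_mul` the factor γ(Sb(h₃)h₂) collapses to 1, so the sum lies in the image of A. This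
is what makes γ' a two-sided inverse. -/
theorem sw_γ_twist_mul (hSb : IsTwistedAntipode Sb) (a : A) (h : H) :
    sw R (fun x y => E.γ (Sb y) * (E.ι a * E.γ x)) h =
      E.ι (sw R (fun x y => phiMap w σ Sb (x ⊗ₜ a) y) h) := by
  simp_rw [E.γ_twist_mul hSb]
  refine (sw_congr fun x y => sw_comm _ _ _).trans ?_
  simp (disch := fun_prop) only [sw_assoc, map_sw (IsLin.algHom E.ι)]
  refine sw_congr fun x y => ?_
  rw [hSb.sw_sw_twist_mul (fun u s => E.ι (phiMap w σ Sb (x ⊗ₜ a) s) * E.γ u) (by fun_prop)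
    (by fun_prop), E.γ_one, mul_one]

/-- No further cocycle identity is needed: by `sw_γ_twist_mul` the sum is ι(g(k)) for some g : H →
A, and applying p to ∑ ι(g(k₂))γ(Sb(k₁)) = γ(Sb(k)) forces g(k) = ε(k)1. -/
theorem γ_mul_γt (hSb : IsTwistedAntipode Sb) (hτ : IsConvInverse σ τ) (k : H) :
    sw R (fun x y => E.γ (Sb y) * E.γt τ Sb x) k = counit (R := R) k • 1 := by
  have h₁ (k : H) : sw R (fun x y => E.γ (Sb y) * E.γt τ Sb x) k =
      E.ι (sw R (fun x y => sw R (fun y z =>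
        phiMap w σ Sb (y ⊗ₜ twistedCocycle τ Sb x) z) y) k) := by
    simp_rw [map_sw (IsLin.algHom E.ι) (fun _ _ => sw R _ _), ← E.sw_γ_twist_mul hSb, γt_eq]
    simp (disch := fun_prop) only [mul_sw, sw_assoc]
  have h₂ : sw R (fun x y => sw R (fun a b => E.γ (Sb b) * E.γt τ Sb a) y * E.γ (Sb x)) k =
      E.γ (Sb k) := by
    simp_rw [sw_mul_const, mul_assoc]
    rw [← sw_assoc (fun x a b => E.γ (Sb b) * (E.γt τ Sb a * E.γ (Sb x))) (by fun_prop)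
      (by fun_prop) (by fun_prop)]
    simp_rw [← mul_sw, E.γt_mul_γ hSb hτ, mul_smul_comm, mul_one]
    exact sw_counit_left (fun z => E.γ (Sb z)) (by fun_prop) k
  have h₃ := congrArg E.p h₂
  simp_rw [h₁, map_sw (IsLin.linearMap E.p) (fun _ _ => _ * _), E.p_apply, hSb.counit_apply] at h₃
  rw [sw_counit_left _ (by fun_prop)] at h₃
  rw [h₁, h₃, ← one_mul (E.γ _), ← map_one E.ι, E.p_apply, hSb.counit_apply, map_smul]

/-- `∑ φ(h₁ ⊗ a)(h₂ k₂) γ(Sb(k₁)) = ∑ γ(Sb(h₂ k)) a γ(h₁)`. -/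
theorem sw_phi_mul_γ (hSb : IsTwistedAntipode Sb) (a : A) (h k : H) :
    sw R (fun x y => sw R (fun c s =>
      E.ι (phiMap w σ Sb (x ⊗ₜ a) (y * s)) * E.γ (Sb c)) k) h =
      sw R (fun x y => E.γ (Sb (y * k)) * (E.ι a * E.γ x)) h := by
  simp_rw [E.γ_twist_mul hSb]
  simp (disch := fun_prop) only [sw_mul, hSb.map_mul]
  refine Eq.trans ?_ (sw_congr fun x y =>
    (sw_congr fun _ _ => sw_comm _ _ _).trans (sw_comm _ _ _)).symm
  simp (disch := fun_prop) only [sw_assoc, mul_assoc]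
  refine sw_congr fun x y => ?_
  rw [hSb.sw_sw_twist_mul (fun u v => sw R (fun c s =>
    E.ι (phiMap w σ Sb (x ⊗ₜ a) (v * s)) * E.γ (Sb c * u)) k) (by fun_prop) (by fun_prop)]
  simp_rw [mul_one]

/-- `sw_phi_mul_γ` solved for φ: the factor γ(Sb(·)) on the right is removed with γ' by `γ_mul_γt`.
-/
theorem ι_sw_phi (hSb : IsTwistedAntipode Sb) (hτ : IsConvInverse σ τ) (a : A) (h k : H) :
    sw R (fun x y => E.ι (phiMap w σ Sb (x ⊗ₜ a) (y * k))) h =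
      sw R (fun x y => sw R (fun c s =>
        E.γ (Sb (y * s)) * (E.ι a * E.γ x) * E.γt τ Sb c) k) h := by
  rw [sw_comm]
  simp_rw [← sw_mul_const, ← E.sw_phi_mul_γ hSb, sw_mul_const]
  rw [sw_comm]
  refine sw_congr fun x y => ?_
  rw [← sw_assoc (fun b c s => E.ι (phiMap w σ Sb (x ⊗ₜ a) (y * s)) * E.γ (Sb c) * E.γt τ Sb b)
    (by fun_prop) (by fun_prop) (by fun_prop)]
  simp_rw [mul_assoc, ← mul_sw, E.γ_mul_γt hSb hτ, mul_smul_comm, mul_one]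
  exact (sw_counit_left (fun s => E.ι (phiMap w σ Sb (x ⊗ₜ a) (y * s))) (by fun_prop) k).symm

/-- `a γ(h) γ'(k) = ∑ γ'(h₃ k₂) φ(h₁ ⊗ a)(h₂ k₁)`. -/
theorem ι_mul_γ_mul_γt (hSb : IsTwistedAntipode Sb) (hτ : IsConvInverse σ τ) (a : A) (h k : H) :
    E.ι a * E.γ h * E.γt τ Sb k = sw R (fun x r => sw R (fun y z => sw R (fun c d =>
      E.γt τ Sb (z * d) * E.ι (phiMap w σ Sb (x ⊗ₜ a) (y * c))) k) r) h := by
  symm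
  rw [← sw_assoc (fun x y z => sw R (fun c d =>
    E.γt τ Sb (z * d) * E.ι (phiMap w σ Sb (x ⊗ₜ a) (y * c))) k) (by fun_prop) (by fun_prop)
    (by fun_prop)]
  have h₁ (x z : H) : sw R (fun x y => sw R (fun c d =>
      E.γt τ Sb (z * d) * E.ι (phiMap w σ Sb (x ⊗ₜ a) (y * c))) k) x =
      sw R (fun b y => sw R (fun c t => sw R (fun s d => E.γt τ Sb (z * d) *
        (E.γ (Sb (y * s)) * (E.ι a * E.γ b) * E.γt τ Sb c)) t) k) x := by
    rw [sw_comm]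
    simp_rw [← mul_sw, E.ι_sw_phi hSb hτ, mul_sw]
    rw [sw_comm]
    simp (disch := fun_prop) only [sw_assoc]
  simp_rw [h₁]
  rw [sw_assoc (fun b y z => sw R (fun c t => sw R (fun s d => E.γt τ Sb (z * d) *
    (E.γ (Sb (y * s)) * (E.ι a * E.γ b) * E.γt τ Sb c)) t) k) (by fun_prop) (by fun_prop)
    (by fun_prop)]
  -- After φ is replaced through `ι_sw_phi`, the pair γ'(u₂)γ(Sb(u₁)) with u = q·t appears and
  -- cancels.
  have h₂ (b q c t : H) : sw R (fun y z => sw R (fun s d => E.γt τ Sb (z * d) *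
      (E.γ (Sb (y * s)) * (E.ι a * E.γ b) * E.γt τ Sb c)) t) q =
      counit (R := R) q • counit (R := R) t • (E.ι a * E.γ b * E.γt τ Sb c) := by
    rw [← sw_mul (fun u v => E.γt τ Sb v * (E.γ (Sb u) * (E.ι a * E.γ b) * E.γt τ Sb c))
      (by fun_prop) (by fun_prop)]
    simp_rw [← mul_assoc, ← sw_mul_const, E.γt_mul_γ hSb hτ, Bialgebra.counit_mul, mul_smul,
      smul_mul_assoc, one_mul]
  have h₃ (b q : H) : sw R (fun y z => sw R (fun c t => sw R (fun s d => E.γt τ Sb (z * d) *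
      (E.γ (Sb (y * s)) * (E.ι a * E.γ b) * E.γt τ Sb c)) t) k) q =
      counit (R := R) q • (E.ι a * E.γ b * E.γt τ Sb k) := by
    rw [sw_comm]
    simp_rw [h₂, ← smul_sw]
    rw [sw_counit_right (fun c => E.ι a * E.γ b * E.γt τ Sb c) (by fun_prop)]
  simp_rw [h₃]
  exact sw_counit_right (fun b => E.ι a * E.γ b * E.γt τ Sb k) (by fun_prop) h

/-- The crossed product relations move a and then γ(z) past the γ inside γ'(y); the coefficients
collected on the left are the core of ψ. -/
theorem γt_mul_ι_mul_γ (a : A) (y z : H) :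
    E.γt τ Sb y * E.ι a * E.γ z = sw R (fun y₁ y₂ => sw R (fun z₁ z₂ =>
      E.ι (psiCore w σ τ Sb a y₁ z₁) * E.γ (y₂ * z₂)) z) y := by
  have h₁ (v : H) : E.γ v * (E.ι a * E.γ z) = sw R (fun v₁ v₂ => sw R (fun c d =>
      sw R (fun z₁ z₂ => E.ι (w.act v₁ a) * (E.ι (σ (c ⊗ₜ z₁)) * E.γ (d * z₂))) z) v₂) v := by
    rw [← mul_assoc, E.γ_mul_ι, sw_mul_const]
    simp_rw [mul_assoc, E.γ_mul_γ, mul_sw]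
  simp_rw [γt_eq, sw_mul_const, mul_assoc, h₁, psiCore_apply, map_sw (IsLin.algHom E.ι), map_mul,
    sw_mul_const, mul_sw, mul_assoc]
  refine Eq.trans ?_ (sw_congr fun _ _ => (sw_comm _ _ _).trans
    (sw_congr fun _ _ => sw_comm _ _ _)).symm
  simp (disch := fun_prop) only [sw_assoc]

/-- `∑ γ'(h k₂) a γ(Sb(k₁)) = ∑ ψ(h₁ ⊗ a)(h₂ k₂) γ(h₃ k₃ Sb(k₁))`. -/
theorem sw_γt_mul_ι_mul_γ (hSb : IsTwistedAntipode Sb) (a : A) (h k : H) :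
    sw R (fun x s => E.γt τ Sb (h * s) * E.ι a * E.γ (Sb x)) k =
      sw R (fun h₁ r => sw R (fun h₂ h₃ => sw R (fun x s => sw R (fun k₂ k₃ =>
        E.ι (psiMap w σ τ Sb (h₁ ⊗ₜ a) (h₂ * k₂)) * E.γ (h₃ * k₃ * Sb x)) s) k) r) h := by
  rw [← sw_assoc (fun h₁ h₂ h₃ => sw R (fun x s => sw R (fun k₂ k₃ =>
    E.ι (psiMap w σ τ Sb (h₁ ⊗ₜ a) (h₂ * k₂)) * E.γ (h₃ * k₃ * Sb x)) s) k) (by fun_prop)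
    (by fun_prop) (by fun_prop)]
  simp (disch := fun_prop) only [γt_mul_ι_mul_γ, sw_mul, hSb.sw_apply]
  refine (sw_comm _ _ _).trans (sw_congr fun p q => ?_)
  refine Eq.trans ?_ ((sw_comm _ _ _).trans (sw_congr fun _ _ => sw_comm _ _ _)).symm
  -- With γ(Sb(k₁)) split by `sw_apply`, `psiMap_twist` identifies the coefficients as values of ψ.
  simp_rw [← sw_mul_const, ← map_sw (IsLin.algHom E.ι), psiMap_twist hSb,
    map_sw (IsLin.algHom E.ι), sw_mul_const]
  refine (sw_congr fun _ _ => sw_comm _ _ _).trans ?_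
  simp (disch := fun_prop) only [sw_assoc]

end CrossedPresentation

/-! ### The action of B # U on B for a comodule algebra B. -/

section Hit

variable {R H B : Type*} [CommRing R] [Ring H] [Bialgebra R H] [Ring B] [Algebra R B]

/-- The action `f ⇀ b = ∑ b₍₀₎ f(b₍₁₎)` of `H^*` on a right `H`-comodule `B`. -/
def hit (δ : B →ₗ[R] B ⊗[R] H) : Module.Dual R H →ₗ[R] B →ₗ[R] B where
  toFun f := (TensorProduct.rid R B).toLinearMap ∘ₗ f.lTensor B ∘ₗ δ
  map_add' f g := by simp [LinearMap.lTensor_add, LinearMap.add_comp, LinearMap.comp_add]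
  map_smul' r f := by simp [LinearMap.lTensor_smul, LinearMap.smul_comp, LinearMap.comp_smul]

variable {δ : B →ₗ[R] B ⊗[R] H}

theorem hit_of_eq_sum {f : Module.Dual R H} {b : B} {s : Finset (B × H)}
    (hs : δ b = ∑ i ∈ s, i.1 ⊗ₜ[R] i.2) : hit δ f b = ∑ i ∈ s, f i.2 • i.1 := by
  simp [hit, hs]

theorem hit_of_eq_sw {f : Module.Dual R H} {b : B} {F : H → H → B} {G : H → H → H} {k : H}
    (hs : δ b = sw R (fun x y => F x y ⊗ₜ[R] G x y) k) :
    hit δ f b = sw R (fun x y => f (G x y) • F x y) k := by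
  simp [hit, hs, sw]

theorem hit_mul (hδ : ∀ x y, δ (x * y) = δ x * δ y) (f : Module.Dual R H) {b : B}
    {s : Finset (B × H)} (hs : δ b = ∑ i ∈ s, i.1 ⊗ₜ[R] i.2) (y : B) :
    hit δ f (b * y) = ∑ i ∈ s, i.1 * hit δ (rightReg f i.2) y := by
  obtain ⟨t, ht⟩ := TensorProduct.exists_finset (δ y)
  simp only [hit_of_eq_sum ht, Finset.mul_sum]
  simp [hit, hδ, hs, ht, Finset.sum_mul_sum, rightReg]

theorem hit_conv (hδ : (TensorProduct.assoc R B H H).toLinearMap ∘ₗ δ.rTensor H ∘ₗ δ =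
    (comul (R := R) (A := H)).lTensor B ∘ₗ δ) (f g : WithConv (Module.Dual R H)) (y : B) :
    hit δ (f * g).ofConv y = hit δ f.ofConv (hit δ g.ofConv y) := by
  obtain ⟨s, hs⟩ := TensorProduct.exists_finset (δ y)
  have h₁ := congrArg ((TensorProduct.rid R B).toLinearMap ∘ₗ
    (LinearMap.mul' R R ∘ₗ TensorProduct.map f.ofConv g.ofConv).lTensor B)
    (LinearMap.congr_fun hδ y)
  have h₂ : ∀ z : B ⊗[R] H, (TensorProduct.rid R B).toLinearMap
      ((LinearMap.mul' R R ∘ₗ TensorProduct.map f.ofConv g.ofConv).lTensor B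
        ((TensorProduct.assoc R B H H) (δ.rTensor H z))) =
      hit δ f.ofConv ((TensorProduct.rid R B) (g.ofConv.lTensor B z)) := fun z => by
    induction z using TensorProduct.induction_on with
    | zero => simp
    | add a b ha hb => simp only [map_add, ha, hb]
    | tmul b h =>
      obtain ⟨t, ht⟩ := TensorProduct.exists_finset (δ b)
      simp [hit_of_eq_sum ht, ht, TensorProduct.sum_tmul, Finset.smul_sum, smul_smul,
        mul_comm]
  simp only [LinearMap.comp_apply] at h₁
  refine Eq.trans ?_ (h₁.symm.trans (h₂ _))
  rw [hs]
  simp [hit, hs, LinearMap.convMul_def]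

variable (δ)

/-- The action of `B # U` on `B`, `(b # f) y = b (f ⇀ y)`. -/
def smashEnd (U : RightModuleSubalgebra R H) : Smash δ U →ₗ[R] B →ₗ[R] B :=
  (TensorProduct.lift ((LinearMap.llcomp R B B B ∘ₗ LinearMap.mul R B).compl₂
    (hit δ ∘ₗ U.incl)) : B ⊗[R] U.Elem →ₗ[R] B →ₗ[R] B)

variable {δ} {U : RightModuleSubalgebra R H}

theorem smashEnd_mk (b : B) (f : U.Elem) (y : B) :
    smashEnd δ U (Smash.mk δ U b f) y = b * hit δ (U.incl f) y := rfl

theorem Smash.induction_on {p : Smash δ U → Prop} (x : Smash δ U) (mk : ∀ b f, p (Smash.mk δ U b f))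
    (add : ∀ x y, p x → p y → p (x + y)) : p x := by
  refine TensorProduct.induction_on (motive := p) x ?_ mk add
  have := mk 0 0
  rwa [show Smash.mk δ U 0 0 = 0 from TensorProduct.zero_tmul _ _] at this

variable (δ U) in
/-- The map `B # U → Hom_R(H, B)`, `b # f ↦ [k ↦ f(k) b]`. -/
def smashPairing : Smash δ U →ₗ[R] H →ₗ[R] B :=
  (pairingMap B U.incl : B ⊗[R] U.Elem →ₗ[R] H →ₗ[R] B)

theorem smashPairing_mk (b : B) (f : U.Elem) (k : H) :
    smashPairing δ U (Smash.mk δ U b f) k = U.incl f k • b := rfl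

/-- The smash product is built for this: f ⇀ (by) = ∑ b₍₀₎((f b₍₁₎) ⇀ y) since δ is multiplicative,
and (f ⋆ g) ⇀ y = f ⇀ (g ⇀ y) since δ is coassociative. -/
theorem smashEnd_mul (hδ : ∀ x y, δ (x * y) = δ x * δ y)
    (hδ' : (TensorProduct.assoc R B H H).toLinearMap ∘ₗ δ.rTensor H ∘ₗ δ =
      (comul (R := R) (A := H)).lTensor B ∘ₗ δ) (x y : Smash δ U) :
    smashEnd δ U (x * y) = smashEnd δ U x ∘ₗ smashEnd δ U y := by
  induction x using Smash.induction_on with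
  | add x x' hx hx' => rw [add_mul, map_add, map_add, hx, hx', LinearMap.add_comp]
  | mk b f =>
    induction y using Smash.induction_on with
    | add y y' hy hy' => rw [mul_add, map_add, map_add, hy, hy', LinearMap.comp_add]
    | mk b' f' =>
      obtain ⟨s, hs⟩ := TensorProduct.exists_finset (δ b')
      have h : Smash.mk δ U b f * Smash.mk δ U b' f' =
          ∑ i ∈ s, Smash.mk δ U (b * i.1) (U.act f i.2 * f') := by
        rw [Smash.mul_def]
        simp only [Smash.mulMap, Smash.mk, TensorProduct.lift.tmul, LinearMap.mk₂_apply,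
          LinearMap.comp_apply, LinearMap.rTensor_tmul, hs, TensorProduct.sum_tmul, map_sum]
        rfl
      ext z
      rw [h, map_sum, LinearMap.sum_apply, LinearMap.comp_apply, smashEnd_mk, smashEnd_mk,
        hit_mul hδ _ hs, Finset.mul_sum]
      refine Finset.sum_congr rfl fun i _ => ?_
      rw [smashEnd_mk, mul_assoc]
      congr 2
      exact hit_conv hδ' _ _ _

theorem lambdaMap_eq (x : SmashSelf U) : lambdaMap U x = smashEnd comul U x := by
  induction x using Smash.induction_on with
  | add x y hx hy => rw [map_add, ← hx, ← hy]; exact map_add _ _ _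
  | mk b f => rfl

end Hit

/-! ### The comodule algebra B, the map ν, and B # U inside Hom_R(A ⊗ H, B). -/

namespace CrossedPresentation

variable {R H A B : Type*} [CommRing R] [Ring H] [Bialgebra R H] [Ring A]
    [Algebra R A] [Ring B] [Algebra R B] {w : WeakAction R H A} {σ τ : H ⊗[R] H →ₗ[R] A}
    {δ : B →ₗ[R] B ⊗[R] H} (E : CrossedPresentation w σ δ) {Sb : H →ₗ[R] H}

theorem induction_on {p : B → Prop} (b : B) (mk : ∀ a h, p (E.ι a * E.γ h))
    (add : ∀ x y, p x → p y → p (x + y)) : p b := by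
  obtain ⟨x, rfl⟩ := E.exists_rep b
  induction x using TensorProduct.induction_on with
  | zero => simpa using mk 0 0
  | tmul a h => exact mk a h
  | add x y hx hy => rw [map_add]; exact add _ _ hx hy

theorem mul_apply (a : A) (h : H) (b : A) (k : H) : E.ι a * E.γ h * (E.ι b * E.γ k) =
    sw R (fun x y => sw R (fun c d => sw R (fun e f =>
      E.ι (a * w.act x b * σ (c ⊗ₜ e)) * E.γ (d * f)) k) y) h := by
  have : E.ι a * E.γ h * (E.ι b * E.γ k) = E.ι a * (E.γ h * E.ι b * E.γ k) := by noncomm_ring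
  rw [this, E.γ_mul_ι]
  simp_rw [sw_mul_const, mul_assoc, E.γ_mul_γ, mul_sw, map_mul, mul_assoc]

theorem δ_mul (E : CrossedPresentation w σ δ) (x y : B) : δ (x * y) = δ x * δ y := by
  induction x using E.induction_on with
  | add x x' hx hx' => simp only [add_mul, map_add, hx, hx']
  | mk a h =>
    induction y using E.induction_on with
    | add y y' hy hy' => simp only [mul_add, map_add, hy, hy']
    | mk b k =>
      simp_rw [E.δ_apply, sw_mul_const, mul_sw, Algebra.TensorProduct.tmul_mul_tmul, E.mul_apply,
        sw_tmul, map_sw (IsLin.linearMap δ), E.δ_apply]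
      simp (disch := fun_prop) only [sw_mul]
      refine (sw_congr fun _ _ => sw_congr fun _ _ => sw_comm _ _ _).trans ?_
      refine Eq.trans ?_ (sw_congr fun _ _ => (sw_comm _ _ _).trans
        (sw_congr fun _ _ => sw_comm _ _ _)).symm
      simp (disch := fun_prop) only [sw_assoc]

theorem δ_coassoc (E : CrossedPresentation w σ δ) :
    (TensorProduct.assoc R B H H).toLinearMap ∘ₗ δ.rTensor H ∘ₗ δ =
      (comul (R := R) (A := H)).lTensor B ∘ₗ δ := by
  ext b
  induction b using E.induction_on with
  | add x x' hx hx' => simp only [map_add, hx, hx']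
  | mk a h =>
    simp_rw [LinearMap.comp_apply, E.δ_apply, map_sw (IsLin.linearMap (δ.rTensor H)),
      map_sw (IsLin.linearMap (comul.lTensor B)), LinearMap.rTensor_tmul, LinearMap.lTensor_tmul,
      E.δ_apply, sw_tmul, LinearEquiv.coe_coe,
      map_sw (IsLin.linearEquiv (TensorProduct.assoc R B H H)), TensorProduct.assoc_tmul,
      comul_eq_sw, tmul_sw]
    simp (disch := fun_prop) only [sw_assoc]

/-- Elements of A are coinvariant and γ' is colinear, so ν turns id ⊗ Δ into δ. -/
theorem δ_γt_mul_ι (k : H) (a : A) : δ (E.γt τ Sb k * E.ι a) =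
    sw R (fun x y => (E.γt τ Sb x * E.ι a) ⊗ₜ[R] y) k := by
  have h₁ : δ (E.ι a) = E.ι a ⊗ₜ 1 := by
    rw [← mul_one (E.ι a), ← E.γ_one, E.δ_apply, sw_one _ (by fun_prop) (by fun_prop)]
  have h₂ : δ (E.γt τ Sb k) = sw R (fun x y => E.γt τ Sb x ⊗ₜ[R] y) k := by
    simp_rw [γt_eq, map_sw (IsLin.linearMap δ), E.δ_apply, sw_tmul]
    simp (disch := fun_prop) only [sw_assoc]
  simp_rw [E.δ_mul, h₁, h₂, sw_mul_const, Algebra.TensorProduct.tmul_mul_tmul, mul_one]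

theorem hit_γt_mul_ι (f : Module.Dual R H) (k : H) (a : A) : hit δ f (E.γt τ Sb k * E.ι a) =
    sw R (fun x y => f y • (E.γt τ Sb x * E.ι a)) k := hit_of_eq_sw (E.δ_γt_mul_ι k a)

/-- The map `A ⊗ H → B`, `a ⊗ h ↦ γ'(h) a`. -/
def normalBasis (τ : H ⊗[R] H →ₗ[R] A) (Sb : H →ₗ[R] H) : A ⊗[R] H →ₗ[R] B :=
  TensorProduct.lift ((LinearMap.mul R B).flip.compl₁₂ E.ι.toLinearMap (E.γt τ Sb))

@[simp]
theorem normalBasis_tmul (a : A) (h : H) : E.normalBasis τ Sb (a ⊗ₜ h) = E.γt τ Sb h * E.ι a := rfl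

theorem p_ι (a : A) : E.p (E.ι a) = a := by
  rw [← mul_one (E.ι a), ← E.γ_one, E.p_apply, Bialgebra.counit_one, one_smul]

theorem normalBasis_injective (hSb : IsTwistedAntipode Sb) (hτ : IsConvInverse σ τ) :
    Function.Injective (E.normalBasis τ Sb) := by
  -- The left inverse of ν is b ↦ ∑ p(γ(Sb(b₍₁₎))b₍₀₎) ⊗ b₍₂₎; on γ'(k)a the factors γ(Sb(·)) and γ'
  -- cancel.
  let N : B ⊗[R] H →ₗ[R] A ⊗[R] H := E.p.rTensor H ∘ₗ
    lift₂ (fun b h => sw R (fun x y => (E.γ (Sb x) * b) ⊗ₜ[R] y) h) (by fun_prop) (by fun_prop)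
  refine Function.LeftInverse.injective (g := N ∘ₗ δ) fun z => ?_
  induction z using TensorProduct.induction_on with
  | zero => simp
  | add x y hx hy => rw [map_add, map_add, hx, hy]
  | tmul a k =>
    rw [normalBasis_tmul, LinearMap.comp_apply, E.δ_γt_mul_ι, map_sw (IsLin.linearMap N)]
    simp only [N, LinearMap.comp_apply, lift₂_tmul]
    rw [← map_sw (IsLin.linearMap (E.p.rTensor H)) (fun x y => sw R _ y),
      ← sw_assoc (fun x c y => (E.γ (Sb c) * (E.γt τ Sb x * E.ι a)) ⊗ₜ[R] y) (by fun_prop)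
      (by fun_prop) (by fun_prop)]
    simp_rw [← sw_tmul, ← mul_assoc, ← sw_mul_const, E.γ_mul_γt hSb hτ, smul_mul_assoc, one_mul,
      ← TensorProduct.smul_tmul']
    rw [sw_counit_left (fun y => E.ι a ⊗ₜ[R] y) (by fun_prop)]
    simp [p_ι]

/-- The action of `B # U` on `B`, in the coordinates given by `normalBasis`. -/
def smashHom (U : RightModuleSubalgebra R H) (τ : H ⊗[R] H →ₗ[R] A) (Sb : H →ₗ[R] H) :
    Smash δ U →ₗ[R] A ⊗[R] H →ₗ[R] B :=
  (E.normalBasis τ Sb).lcomp R B ∘ₗ smashEnd δ U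

theorem smashHom_apply {U : RightModuleSubalgebra R H} (z : Smash δ U) (x : A ⊗[R] H) :
    E.smashHom U τ Sb z x = smashEnd δ U z (E.normalBasis τ Sb x) := rfl

/-- The operator of z depends only on the function k ↦ α(z)(k), so a preimage under this map can be
found by prescribing that function. -/
theorem smashHom_tmul {U : RightModuleSubalgebra R H} (z : Smash δ U) (a : A) (k : H) :
    E.smashHom U τ Sb z (a ⊗ₜ k) =
      sw R (fun x y => smashPairing δ U z y * (E.γt τ Sb x * E.ι a)) k := by
  rw [smashHom_apply, normalBasis_tmul]
  induction z using Smash.induction_on with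
  | add z z' hz hz' =>
    rw [map_add, LinearMap.add_apply, hz, hz']
    simp only [map_add, LinearMap.add_apply, add_mul, sw, Finset.sum_add_distrib]
  | mk b f =>
    rw [smashEnd_mk, hit_γt_mul_ι, mul_sw]
    refine sw_congr fun x y => ?_
    rw [mul_smul_comm, ← smul_mul_assoc]
    rfl

/-- Inverts `smashHom_tmul` at a = 1: multiplying by γ(Sb(·)) on the right removes γ'. Injectivity
of α thus passes to the action. -/
theorem smashPairing_eq_smashHom (hSb : IsTwistedAntipode Sb) (hτ : IsConvInverse σ τ)
    {U : RightModuleSubalgebra R H} (z : Smash δ U) (k : H) :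
    smashPairing δ U z k =
      sw R (fun x y => E.smashHom U τ Sb z (1 ⊗ₜ y) * E.γ (Sb x)) k := by
  simp_rw [smashHom_tmul, map_one, mul_one, sw_mul_const]
  rw [← sw_assoc (fun x y z' => smashPairing δ U z z' * E.γt τ Sb y * E.γ (Sb x)) (by fun_prop)
    (by fun_prop) (by fun_prop)]
  simp_rw [mul_assoc, ← mul_sw, E.γt_mul_γ hSb hτ, mul_smul_comm, mul_one]
  exact (sw_counit_left (fun y => smashPairing δ U z y) (by fun_prop) k).symm

theorem smashHom_injective (hSb : IsTwistedAntipode Sb) (hτ : IsConvInverse σ τ)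
    {U : RightModuleSubalgebra R H} (hα : Function.Injective (smashPairing δ U)) :
    Function.Injective (E.smashHom U τ Sb) := fun z z' h => hα <| LinearMap.ext fun k => by
  rw [E.smashPairing_eq_smashHom hSb hτ, E.smashPairing_eq_smashHom hSb hτ, h]

end CrossedPresentation

/-! ### The action of A ⊗ (H # U) on A ⊗ H. -/

section

variable (A : Type*) {R H : Type*} [CommRing R] [Ring H] [Bialgebra R H] [Ring A] [Algebra R A]

/-- The action of `A ⊗ (H # U)` on `A ⊗ H`. -/
def tensorEnd (U : RightModuleSubalgebra R H) :
    A ⊗[R] SmashSelf U →ₗ[R] A ⊗[R] H →ₗ[R] A ⊗[R] H :=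
  TensorProduct.homTensorHomMap (RingHom.id R) A H A H ∘ₗ
    TensorProduct.map (LinearMap.mul R A) (smashEnd comul U)

variable {A} {U : RightModuleSubalgebra R H}

@[simp]
theorem tensorEnd_tmul (a b : A) (s : SmashSelf U) (h : H) :
    tensorEnd A U (a ⊗ₜ s) (b ⊗ₜ h) = (a * b) ⊗ₜ smashEnd comul U s h := rfl

theorem smashEnd_comul_mul (x y : SmashSelf U) :
    smashEnd comul U (x * y) = smashEnd comul U x ∘ₗ smashEnd comul U y :=
  smashEnd_mul Bialgebra.comul_mul Coalgebra.coassoc x y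

theorem tensorEnd_mul (x y : A ⊗[R] SmashSelf U) :
    tensorEnd A U (x * y) = tensorEnd A U x ∘ₗ tensorEnd A U y := by
  induction x using TensorProduct.induction_on with
  | zero => simp
  | add x x' hx hx' => rw [add_mul, map_add, map_add, hx, hx', LinearMap.add_comp]
  | tmul a s =>
    induction y using TensorProduct.induction_on with
    | zero => simp
    | add y y' hy hy' => rw [mul_add, map_add, map_add, hy, hy', LinearMap.comp_add]
    | tmul b t =>
      ext c h
      simp [Algebra.TensorProduct.tmul_mul_tmul, smashEnd_comul_mul, mul_assoc]

theorem hit_comul_apply (f : Module.Dual R H) (k : H) :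
    hit comul f k = sw R (fun x y => f y • x) k := hit_of_eq_sw (comul_eq_sw k)

/-- For s = h # f the sum is ∑ h k₂ Sb(k₁) f(k₃) = f(k)h, so Sb alone recovers the pairing. -/
theorem sw_smashEnd_mul_twist {Sb : H →ₗ[R] H} (hSb : IsTwistedAntipode Sb) (s : SmashSelf U)
    (k : H) : sw R (fun x y => smashEnd comul U s y * Sb x) k = smashPairing comul U s k := by
  induction s using Smash.induction_on with
  | add s t hs ht =>
    rw [map_add (smashPairing comul U), LinearMap.add_apply, ← hs, ← ht]
    simp only [map_add, LinearMap.add_apply, add_mul, sw, Finset.sum_add_distrib]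
  | mk h f =>
    simp_rw [smashEnd_mk, hit_comul_apply, mul_sw, sw_mul_const, mul_smul_comm, smul_mul_assoc,
      mul_assoc]
    rw [hSb.sw_sw_mul_twist (fun u y => U.incl f y • (h * u)) (by fun_prop) (by fun_prop), mul_one]
    rfl

variable (A U) in
/-- The map `A ⊗ (H # U) → Hom_R(H, A ⊗ H)`, `a ⊗ (h # f) ↦ [k ↦ f(k) (a ⊗ h)]`. -/
def tensorPairing : A ⊗[R] SmashSelf U →ₗ[R] H →ₗ[R] A ⊗[R] H :=
  (pairingMap (A ⊗[R] H) U.incl ∘ₗ (TensorProduct.assoc R A H U.Elem).symm.toLinearMap :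
    A ⊗[R] (H ⊗[R] U.Elem) →ₗ[R] H →ₗ[R] A ⊗[R] H)

theorem tensorPairing_injective (hα : Function.Injective (pairingMap (A ⊗[R] H) U.incl)) :
    Function.Injective (tensorPairing A U) :=
  hα.comp (TensorProduct.assoc R A H U.Elem).symm.injective

theorem tensorPairing_tmul (a : A) (s : SmashSelf U) (k : H) :
    tensorPairing A U (a ⊗ₜ s) k = a ⊗ₜ smashPairing comul U s k := by
  induction s using Smash.induction_on with
  | add s t hs ht => simp only [TensorProduct.tmul_add, map_add, LinearMap.add_apply, hs, ht]
  | mk h f => exact (TensorProduct.tmul_smul _ _ _).symm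

theorem tensorEnd_injective {Sb : H →ₗ[R] H} (hSb : IsTwistedAntipode Sb)
    (hα : Function.Injective (pairingMap (A ⊗[R] H) U.incl)) :
    Function.Injective (tensorEnd A U) := by
  have key (z : A ⊗[R] SmashSelf U) (k : H) :
      sw R (fun x y => tensorEnd A U z (1 ⊗ₜ y) * (1 ⊗ₜ Sb x)) k = tensorPairing A U z k := by
    induction z using TensorProduct.induction_on with
    | zero => simp [sw]
    | add z z' hz hz' =>
      rw [map_add (tensorPairing A U), LinearMap.add_apply, ← hz, ← hz']
      simp only [map_add, LinearMap.add_apply, add_mul, sw, Finset.sum_add_distrib]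
    | tmul a s =>
      simp_rw [tensorEnd_tmul, Algebra.TensorProduct.tmul_mul_tmul, mul_one, ← tmul_sw,
        sw_smashEnd_mul_twist hSb, tensorPairing_tmul]
  intro z z' h
  apply tensorPairing_injective hα
  ext1 k
  rw [← key, ← key, h]

end

theorem sw_linearMap_apply {R C M N : Type*} [CommRing R] [AddCommGroup C] [Module R C]
    [CoalgebraStruct R C] [AddCommGroup M] [Module R M] [AddCommGroup N] [Module R N]
    (F : C → C → M →ₗ[R] N) (h : C) (m : M) :
    sw R F h m = sw R (fun x y => F x y m) h := LinearMap.sum_apply ..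

theorem sw_mem {R C M : Type*} [CommRing R] [AddCommGroup C] [Module R C]
    [CoalgebraStruct R C] [AddCommGroup M] [Module R M] {p : Submodule R M}
    {F : C → C → M} (hF : ∀ x y, F x y ∈ p) (h : C) : sw R F h ∈ p :=
  p.sum_mem fun _ _ => hF _ _

theorem pairingMap_comp_mulLeft {R H A : Type*} [CommRing R] [Ring H] [Bialgebra R H] [Ring A]
    [Algebra R A] {V : Submodule R (Module.Dual R H)} (a : A) (v : V) (y : H) :
    pairingMap A V.subtype (a ⊗ₜ v) ∘ₗ LinearMap.mulLeft R y =
      (rightReg (v : Module.Dual R H) y).smulRight a := LinearMap.ext fun _ => rfl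

/-! ### Equality of the two ranges and the isomorphism. -/

namespace CrossedPresentation

variable {R H A B : Type*} [CommRing R] [Ring H] [Bialgebra R H] [Ring A]
    [Algebra R A] [Ring B] [Algebra R B] {w : WeakAction R H A} {σ τ : H ⊗[R] H →ₗ[R] A}
    {δ : B →ₗ[R] B ⊗[R] H} (E : CrossedPresentation w σ δ) {Sb : H →ₗ[R] H}
    {U : RightModuleSubalgebra R H} {V : Submodule R (Module.Dual R H)}

/-- The action of `A ⊗ (H # U)` on `A ⊗ H`, with values in `B` through `normalBasis`. -/
def tensorHom (U : RightModuleSubalgebra R H) (τ : H ⊗[R] H →ₗ[R] A) (Sb : H →ₗ[R] H) :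
    A ⊗[R] SmashSelf U →ₗ[R] A ⊗[R] H →ₗ[R] B :=
  LinearMap.llcomp R (A ⊗[R] H) (A ⊗[R] H) B (E.normalBasis τ Sb) ∘ₗ tensorEnd A U

theorem tensorHom_apply (z : A ⊗[R] SmashSelf U) (x : A ⊗[R] H) :
    E.tensorHom U τ Sb z x = E.normalBasis τ Sb (tensorEnd A U z x) := rfl

theorem tensorHom_injective (hSb : IsTwistedAntipode Sb) (hτ : IsConvInverse σ τ)
    (hα : Function.Injective (pairingMap (A ⊗[R] H) U.incl)) :
    Function.Injective (E.tensorHom U τ Sb) := fun _ _ h =>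
  tensorEnd_injective hSb hα <| LinearMap.ext fun x =>
    E.normalBasis_injective hSb hτ (LinearMap.congr_fun h x)

/-- `b ⊗ k ↦ ∑ f(k₃) γ'(h k₂) g(k₁) b`. -/
def forwardTerm (τ : H ⊗[R] H →ₗ[R] A) (Sb : H →ₗ[R] H) (h : H) (f : Module.Dual R H) :
    (H →ₗ[R] A) →ₗ[R] A ⊗[R] H →ₗ[R] B :=
  IsLin.toLinearMap (R := R) (f := fun g : H →ₗ[R] A =>
    lift₂ (R := R) (fun (b : A) (k : H) => sw R (fun u v => f v • sw R (fun c d =>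
      E.γt τ Sb (h * d) * (E.ι (g c) * E.ι b)) u) k) (by fun_prop) (by fun_prop))
    ⟨fun g g' => TensorProduct.ext' fun b k => by
      simp [sw, mul_add, add_mul, Finset.sum_add_distrib, smul_add],
     fun r g => TensorProduct.ext' fun b k => by
      simp [sw, Finset.smul_sum, smul_comm r]⟩

theorem forwardTerm_tmul (h : H) (f : Module.Dual R H) (g : H →ₗ[R] A) (b : A) (k : H) :
    E.forwardTerm τ Sb h f g (b ⊗ₜ k) = sw R (fun u v => f v • sw R (fun c d =>
      E.γt τ Sb (h * d) * (E.ι (g c) * E.ι b)) u) k := rfl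

/-- When g = v(·)a, the scalars v(k₁) assemble into k ↼ v, the first operator applied to k. The
RL-condition supplies an s in H # U with this action, and h # f acts after it. -/
theorem forwardTerm_smulRight (h : H) (f : U.Elem) (v : Module.Dual R H) (a : A)
    {s : SmashSelf U} (hs : smashEnd comul U s = rightHit v) :
    E.forwardTerm τ Sb h (U.incl f) (v.smulRight a) =
      E.tensorHom U τ Sb (a ⊗ₜ (Smash.mk _ U h f * s)) := by
  refine TensorProduct.ext' fun b k => ?_
  simp_rw [tensorHom_apply, tensorEnd_tmul, normalBasis_tmul, smashEnd_comul_mul,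
    LinearMap.comp_apply, hs, rightHit_apply, map_sw (IsLin.linearMap (smashEnd comul U _)),
    map_smul, smashEnd_mk, hit_comul_apply, mul_sw, smul_sw, map_sw (IsLin.linearMap (E.γt τ Sb)),
    sw_mul_const, forwardTerm_tmul, smul_sw]
  rw [sw_assoc (fun c d v' => U.incl f v' • (E.γt τ Sb (h * d) *
    (E.ι (v.smulRight a c) * E.ι b))) (by fun_prop) (by fun_prop) (by fun_prop)]
  refine sw_congr fun c r => sw_congr fun d g => ?_
  simp [smul_comm (v c)]

/-- Rewrites aγ(h)γ'(k) by `ι_mul_γ_mul_γt`, so that only φ has to be decomposed. -/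
theorem smashHom_mk (a : A) (h : H) (f : U.Elem) (hSb : IsTwistedAntipode Sb)
    (hτ : IsConvInverse σ τ) :
    E.smashHom U τ Sb (Smash.mk δ U (E.ι a * E.γ h) f) = sw R (fun x r => sw R (fun y z =>
      E.forwardTerm τ Sb z (U.incl f) (phiMap w σ Sb (x ⊗ₜ a) ∘ₗ LinearMap.mulLeft R y)) r) h := by
  refine TensorProduct.ext' fun b k => ?_
  simp_rw [smashHom_apply, smashEnd_mk, normalBasis_tmul, hit_γt_mul_ι, sw_linearMap_apply,
    forwardTerm_tmul, mul_sw, mul_smul_comm, ← mul_assoc, E.ι_mul_γ_mul_γt hSb hτ, sw_mul_const,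
    smul_sw]
  refine (sw_comm _ _ _).trans (sw_congr fun _ _ => (sw_comm _ _ _))

theorem range_smashHom_le (hSb : IsTwistedAntipode Sb) (hτ : IsConvInverse σ τ)
    (hV : ∀ g ∈ V, ∀ h : H, rightReg g h ∈ V) (hVU : IsCompatible w σ τ Sb V U) :
    LinearMap.range (E.smashHom U τ Sb) ≤ LinearMap.range (E.tensorHom U τ Sb) := by
  have key (t : A ⊗[R] V) (y z : H) (f : U.Elem) : E.forwardTerm τ Sb z (U.incl f)
      (pairingMap A V.subtype t ∘ₗ LinearMap.mulLeft R y) ∈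
        LinearMap.range (E.tensorHom U τ Sb) := by
    induction t using TensorProduct.induction_on with
    | zero => simp
    | add t t' ht ht' => rw [map_add, LinearMap.add_comp, map_add]; exact add_mem ht ht'
    | tmul a v =>
      -- The functional k ↦ v(yk) is v acted on by y; it remains in V, so the RL-condition applies
      -- to it.
      obtain ⟨s, hs⟩ := hVU.rl _ (hV v v.2 y)
      rw [pairingMap_comp_mulLeft,
        E.forwardTerm_smulRight z f _ a ((lambdaMap_eq s).symm.trans hs)]
      exact ⟨_, rfl⟩
  rintro _ ⟨x, rfl⟩
  induction x using Smash.induction_on with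
  | add x y hx hy => rw [map_add]; exact add_mem hx hy
  | mk b f =>
    induction b using E.induction_on with
    | add b b' hb hb' =>
      rw [show Smash.mk δ U (b + b') f = Smash.mk δ U b f + Smash.mk δ U b' f from
        TensorProduct.add_tmul _ _ _, map_add]
      exact add_mem hb hb'
    | mk a h =>
      rw [E.smashHom_mk a h f hSb hτ]
      refine sw_mem (fun x r => sw_mem (fun y z => ?_) _) _
      obtain ⟨t, ht⟩ := hVU.phi_le ⟨x ⊗ₜ a, rfl⟩
      rw [← ht]
      exact key t y z f

/-- `k ↦ ∑ f(k₂) F(k₁)`. -/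
def convDual (f : Module.Dual R H) : (H →ₗ[R] B) →ₗ[R] H →ₗ[R] B :=
  IsLin.toLinearMap (R := R) (f := fun g : H →ₗ[R] B =>
    IsLin.toLinearMap (R := R) (f := fun k : H => sw R (fun x y => f y • g x) k) (by fun_prop))
    ⟨fun g g' => LinearMap.ext fun k => by
      simp [sw, Finset.sum_add_distrib, smul_add],
     fun r g => LinearMap.ext fun k => by
      simp [sw, Finset.smul_sum, smul_comm r]⟩

theorem convDual_apply (f : Module.Dual R H) (g : H →ₗ[R] B) (k : H) :
    convDual f g k = sw R (fun x y => f y • g x) k := rfl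

/-- `k ↦ ∑ γ'(h k₂) a γ(Sb(k₁))`. -/
def backward (τ : H ⊗[R] H →ₗ[R] A) (Sb : H →ₗ[R] H) (a : A) (h : H) : H →ₗ[R] B :=
  IsLin.toLinearMap (R := R) (f := fun k : H =>
    sw R (fun x s => E.γt τ Sb (h * s) * E.ι a * E.γ (Sb x)) k) (by fun_prop)

/-- `k ↦ ∑ g(k₂) γ(h k₃ Sb(k₁))`. -/
def backwardTerm (Sb : H →ₗ[R] H) (h : H) : (H →ₗ[R] A) →ₗ[R] H →ₗ[R] B :=
  IsLin.toLinearMap (R := R) (f := fun g : H →ₗ[R] A =>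
    IsLin.toLinearMap (R := R) (f := fun k : H => sw R (fun x s => sw R (fun c d =>
      E.ι (g c) * E.γ (h * d * Sb x)) s) k) (by fun_prop))
    ⟨fun g g' => LinearMap.ext fun k => by
      simp [sw, Finset.sum_add_distrib, add_mul],
     fun r g => LinearMap.ext fun k => by
      simp [sw, Finset.smul_sum]⟩

theorem backwardTerm_apply (h : H) (g : H →ₗ[R] A) (k : H) :
    E.backwardTerm Sb h g k = sw R (fun x s => sw R (fun c d =>
      E.ι (g c) * E.γ (h * d * Sb x)) s) k := rfl

theorem backward_eq (hSb : IsTwistedAntipode Sb) (a : A) (h : H) :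
    E.backward τ Sb a h = sw R (fun x r => sw R (fun y z =>
      E.backwardTerm Sb z (psiMap w σ τ Sb (x ⊗ₜ a) ∘ₗ LinearMap.mulLeft R y)) r) h := by
  ext k
  simp_rw [sw_linearMap_apply]
  exact E.sw_γt_mul_ι_mul_γ hSb a h k

/-- When g = v(·)a, the term is aγ(h · ∑ (k₂ ↼ v)Sb(k₁)); if s = h' # g' has the action of v,
`sw_smashEnd_mul_twist` reduces it to g'(k) aγ(hh'). Convolving with f stays in range because U is
closed under ⋆. -/
theorem convDual_backwardTerm_smulRight (hSb : IsTwistedAntipode Sb) (h : H) (f : U.Elem)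
    (v : Module.Dual R H) (a : A) {s : SmashSelf U} (hs : smashEnd comul U s = rightHit v) :
    convDual (U.incl f) (E.backwardTerm Sb h (v.smulRight a)) ∈
      LinearMap.range (smashPairing δ U) := by
  have h₁ : E.backwardTerm Sb h (v.smulRight a) = LinearMap.mulLeft R (E.ι a) ∘ₗ E.γ ∘ₗ
      LinearMap.mulLeft R h ∘ₗ smashPairing comul U s := by
    ext k
    simp only [LinearMap.comp_apply, LinearMap.mulLeft_apply, ← sw_smashEnd_mul_twist hSb, hs,
      backwardTerm_apply]
    simp_rw [mul_sw, map_sw (IsLin.linearMap E.γ), mul_sw]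
    refine sw_congr fun x y => ?_
    simp_rw [rightHit_apply, sw_mul_const, mul_sw, map_sw (IsLin.linearMap E.γ), mul_sw]
    refine sw_congr fun c d => ?_
    simp [mul_assoc]
  rw [h₁]
  clear h₁ hs
  induction s using Smash.induction_on with
  | add s t hs ht => simp only [map_add, LinearMap.comp_add]; exact add_mem hs ht
  | mk h' g =>
    refine ⟨Smash.mk δ U (E.ι a * E.γ (h * h')) (g * f), LinearMap.ext fun k => ?_⟩
    have h₂ : U.incl (g * f) k = sw R (fun x y => U.incl g x * U.incl f y) k :=
      conv_mul_apply g.1 f.1 k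
    rw [smashPairing_mk, convDual_apply, h₂, sw, Finset.sum_smul]
    refine Finset.sum_congr rfl fun i _ => ?_
    simp [smashPairing_mk, smul_smul, mul_comm]

theorem convDual_backward_mem (hSb : IsTwistedAntipode Sb)
    (hV : ∀ g ∈ V, ∀ h : H, rightReg g h ∈ V) (hVU : IsCompatible w σ τ Sb V U) (a : A) (h : H)
    (f : U.Elem) :
    convDual (U.incl f) (E.backward τ Sb a h) ∈ LinearMap.range (smashPairing δ U) := by
  have key (t : A ⊗[R] V) (y z : H) : convDual (U.incl f) (E.backwardTerm Sb z
      (pairingMap A V.subtype t ∘ₗ LinearMap.mulLeft R y)) ∈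
        LinearMap.range (smashPairing δ U) := by
    induction t using TensorProduct.induction_on with
    | zero => simp
    | add t t' ht ht' => rw [map_add, LinearMap.add_comp, map_add, map_add]; exact add_mem ht ht'
    | tmul a v =>
      obtain ⟨s, hs⟩ := hVU.rl _ (hV v v.2 y)
      rw [pairingMap_comp_mulLeft]
      exact E.convDual_backwardTerm_smulRight hSb z f _ a ((lambdaMap_eq s).symm.trans hs)
  rw [E.backward_eq hSb, ← Submodule.mem_comap]
  refine sw_mem (fun x r => sw_mem (fun y z => Submodule.mem_comap.2 ?_) _) _
  obtain ⟨t, ht⟩ := hVU.psi_le ⟨x ⊗ₜ a, rfl⟩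
  rw [← ht]
  exact key t y z

theorem range_tensorHom_le (hSb : IsTwistedAntipode Sb) (hτ : IsConvInverse σ τ)
    (hV : ∀ g ∈ V, ∀ h : H, rightReg g h ∈ V) (hVU : IsCompatible w σ τ Sb V U) :
    LinearMap.range (E.tensorHom U τ Sb) ≤ LinearMap.range (E.smashHom U τ Sb) := by
  rintro _ ⟨x, rfl⟩
  induction x using TensorProduct.induction_on with
  | zero => simp
  | add x y hx hy => rw [map_add]; exact add_mem hx hy
  | tmul a s =>
    induction s using Smash.induction_on with
    | add s t hs ht => rw [TensorProduct.tmul_add, map_add]; exact add_mem hs ht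
    | mk h f =>
      -- The preimage z is prescribed by α(z)(k) = ∑ f(k₃) γ'(hk₂) a γ(Sb(k₁)). Applied to γ'(k)b,
      -- the factor γ(Sb(·)) cancels γ' and leaves ∑ f(k₂) γ'(hk₁) ab.
      obtain ⟨z, hz⟩ := E.convDual_backward_mem hSb hV hVU a h f
      refine ⟨z, TensorProduct.ext' fun b k => ?_⟩
      rw [smashHom_tmul, hz]
      simp_rw [convDual_apply, sw_mul_const, smul_mul_assoc]
      rw [← sw_assoc (fun x y v => U.incl f v • (E.backward τ Sb a h y * (E.γt τ Sb x * E.ι b)))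
        (by fun_prop) (by fun_prop) (by fun_prop)]
      have h₁ (k : H) : sw R (fun x y => E.backward τ Sb a h y * (E.γt τ Sb x * E.ι b)) k =
          E.γt τ Sb (h * k) * E.ι (a * b) := by
        have (y : H) : E.backward τ Sb a h y =
          sw R (fun x s => E.γt τ Sb (h * s) * E.ι a * E.γ (Sb x)) y := rfl
        simp_rw [this, sw_mul_const]
        rw [← sw_assoc (fun x c s => E.γt τ Sb (h * s) * E.ι a * E.γ (Sb c) *
          (E.γt τ Sb x * E.ι b)) (by fun_prop) (by fun_prop) (by fun_prop)]
        have (s x c : H) : E.γt τ Sb (h * s) * E.ι a * E.γ (Sb c) * (E.γt τ Sb x * E.ι b) =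
          E.γt τ Sb (h * s) * E.ι a * (E.γ (Sb c) * E.γt τ Sb x * E.ι b) := by noncomm_ring
        simp_rw [this, ← mul_sw, ← sw_mul_const, E.γ_mul_γt hSb hτ, smul_mul_assoc, one_mul,
          mul_smul_comm]
        rw [sw_counit_left (fun s => E.γt τ Sb (h * s) * E.ι a * E.ι b) (by fun_prop),
          map_mul E.ι, mul_assoc]
      simp_rw [← smul_sw, h₁, tensorHom_apply, tensorEnd_tmul, normalBasis_tmul, smashEnd_mk,
        hit_comul_apply, mul_sw, map_sw (IsLin.linearMap (E.γt τ Sb)), sw_mul_const,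
        mul_smul_comm, map_smul, smul_mul_assoc]

theorem hit_counit (E : CrossedPresentation w σ δ) : hit δ counit = LinearMap.id := by
  ext b
  induction b using E.induction_on with
  | add x y hx hy => rw [map_add, map_add, hx, hy]
  | mk a h =>
    rw [hit_of_eq_sw (E.δ_apply a h)]
    exact sw_counit_right (fun x => E.ι a * E.γ x) (by fun_prop) h

theorem exists_equiv (E : CrossedPresentation w σ δ) (hSb : IsTwistedAntipode Sb)
    (hτ : IsConvInverse σ τ)
    (hV : ∀ g ∈ V, ∀ h : H, rightReg g h ∈ V) (hVU : IsCompatible w σ τ Sb V U)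
    (hα : Function.Injective (pairingMap (A ⊗[R] H) U.incl))
    (hα' : Function.Injective (smashPairing δ U)) :
    ∃ e : Smash δ U ≃ₗ[R] A ⊗[R] SmashSelf U,
      (∀ x y, e (x * y) = e x * e y) ∧
      ∀ hε : (1 : WithConv (Module.Dual R H)) ∈ U.toNonUnitalSubalgebra,
        e (Smash.mk _ U 1 ⟨1, hε⟩) = 1 ⊗ₜ[R] Smash.mk _ U 1 ⟨1, hε⟩ := by
  have hP := E.smashHom_injective hSb hτ hα'
  have hQ := E.tensorHom_injective hSb hτ hα
  -- Passage through the common range; `he` records the intertwining relation ν ∘ e(z) = z ∘ ν that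
  -- characterises e.
  let e := LinearEquiv.ofInjective _ hP ≪≫ₗ
    LinearEquiv.ofEq _ _ ((E.range_smashHom_le hSb hτ hV hVU).antisymm
      (E.range_tensorHom_le hSb hτ hV hVU)) ≪≫ₗ (LinearEquiv.ofInjective _ hQ).symm
  have he (z : Smash δ U) : E.tensorHom U τ Sb (e z) = E.smashHom U τ Sb z := by
    have := congrArg Subtype.val ((LinearEquiv.ofInjective _ hQ).apply_symm_apply
      (LinearEquiv.ofEq _ _ ((E.range_smashHom_le hSb hτ hV hVU).antisymm
      (E.range_tensorHom_le hSb hτ hV hVU)) (LinearEquiv.ofInjective _ hP z)))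
    exact this
  refine ⟨e, fun x y => hQ ?_, fun hε => hQ ?_⟩
  · have hx (v) := LinearMap.congr_fun (he x) v
    have hy (v) := LinearMap.congr_fun (he y) v
    simp only [tensorHom_apply, smashHom_apply] at hx hy
    rw [he]
    refine LinearMap.ext fun v => ?_
    rw [smashHom_apply, smashEnd_mul E.δ_mul E.δ_coassoc, tensorHom_apply, tensorEnd_mul,
      LinearMap.comp_apply, LinearMap.comp_apply, hx, hy]
  · have h₁ : U.incl ⟨1, hε⟩ = counit := rfl
    rw [he]
    refine TensorProduct.ext' fun b k => ?_
    rw [smashHom_apply, smashEnd_mk, h₁, E.hit_counit, tensorHom_apply, tensorEnd_tmul,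
      smashEnd_mk, h₁, hit_comul_apply, sw_counit_right (fun x => x) (by fun_prop)]
    simp

end CrossedPresentation

/-! ### A #_σ H as a presented crossed product. -/

section

variable {R H A : Type*} [CommRing R] [Ring H] [Bialgebra R H] [Ring A] [Algebra R A]
  {w : WeakAction R H A} {σ : H ⊗[R] H →ₗ[R] A}

namespace Crossed

@[fun_prop]
theorem isLin_mk_left {M : Type*} [AddCommGroup M] [Module R M] {f : M → A} (h : H)
    (hf : IsLin R f) : IsLin R (fun x => mk w σ (f x) h) :=
  ⟨fun x y => (congrArg (mk w σ · h) (hf.map_add x y)).trans (TensorProduct.add_tmul _ _ _),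
    fun r x => (congrArg (mk w σ · h) (hf.map_smul r x)).trans rfl⟩

@[fun_prop]
theorem isLin_mk_right {M : Type*} [AddCommGroup M] [Module R M] {f : M → H} (a : A)
    (hf : IsLin R f) : IsLin R (fun x => mk w σ a (f x)) :=
  ⟨fun x y => (congrArg (mk w σ a) (hf.map_add x y)).trans (TensorProduct.tmul_add _ _ _),
    fun r x => (congrArg (mk w σ a) (hf.map_smul r x)).trans (TensorProduct.tmul_smul _ _ _)⟩

theorem legs_tmul (h k : H) : legs R H (h ⊗ₜ k) = sw R (fun x y => sw R (fun c d =>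
    sw R (fun e f => x ⊗ₜ[R] ((c ⊗ₜ[R] e) ⊗ₜ[R] (d ⊗ₜ[R] f))) k) y) h := by
  have h₁ (y : H) : (comul (y ⊗ₜ[R] k) : (H ⊗[R] H) ⊗[R] (H ⊗[R] H)) =
      sw R (fun c d : H => sw R (fun e f : H => (c ⊗ₜ[R] e) ⊗ₜ[R] (d ⊗ₜ[R] f)) k) y := by
    rw [comul_eq_sw (R := R), sw_tensor _ (by fun_prop) (by fun_prop)]
  simp_rw [← tmul_sw, ← h₁]
  simp only [legs, LinearMap.comp_apply, LinearMap.rTensor_tmul, comul_eq_sw h, sw_tmul]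
  simp [sw]

theorem mk_mul_mk (a b : A) (h k : H) :
    mk w σ a h * mk w σ b k = sw R (fun x y => sw R (fun c d => sw R (fun e f =>
      mk w σ (a * (w.act x b * σ (c ⊗ₜ e))) (d * f)) k) y) h := by
  have h₁ : mk w σ a h * mk w σ b k =
      (LinearMap.mul R A a).rTensor H (core w σ b (h ⊗ₜ[R] k)) := rfl
  rw [h₁, core, LinearMap.comp_apply, LinearMap.comp_apply, LinearMap.comp_apply, legs_tmul]
  simp only [sw, map_sum, TensorProduct.map_tmul, LinearEquiv.coe_coe,
    TensorProduct.assoc_symm_tmul, LinearMap.rTensor_tmul, LinearMap.mul'_apply]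
  rfl

theorem mk_one_left_mul (h k : H) :
    mk w σ 1 h * mk w σ 1 k = sw R (fun c d => sw R (fun e f =>
      mk w σ (σ (c ⊗ₜ e)) (d * f)) k) h := by
  simp_rw [mk_mul_mk, w.act_one, one_mul, smul_mul_assoc, one_mul,
    (isLin_mk_left (w := w) (σ := σ) _ (IsLin.id (R := R))).map_smul, ← smul_sw]
  exact sw_counit_left (fun y => sw R (fun c d => sw R (fun e f =>
      mk w σ (σ (c ⊗ₜ e)) (d * f)) k) y) (by fun_prop) h

/-- `a # h ↦ ε(h) a`. -/
def proj (w : WeakAction R H A) (σ : H ⊗[R] H →ₗ[R] A) : Crossed w σ →ₗ[R] A :=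
  ((TensorProduct.rid R A).toLinearMap ∘ₗ (counit (R := R) (A := H)).lTensor A : A ⊗[R] H →ₗ[R] A)

theorem proj_mk (a : A) (h : H) : proj w σ (mk w σ a h) = counit (R := R) h • a :=
  TensorProduct.rid_tmul _ _

theorem coaction_mk (a : A) (h : H) :
    coaction w σ (mk w σ a h) = sw R (fun x y => mk w σ a x ⊗ₜ[R] y) h := by
  have : coaction w σ (mk w σ a h) =
    (TensorProduct.assoc R A H H).symm (a ⊗ₜ comul h) := rfl
  rw [this, comul_eq_sw (R := R), tmul_sw,
    map_sw (IsLin.linearEquiv (TensorProduct.assoc R A H H).symm)]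
  rfl

theorem induction_on {p : Crossed w σ → Prop} (x : Crossed w σ) (mk : ∀ a h, p (mk w σ a h))
    (add : ∀ x y, p x → p y → p (x + y)) : p x := by
  refine TensorProduct.induction_on (motive := p) x ?_ mk add
  have := mk 0 0
  rwa [show Crossed.mk w σ 0 0 = 0 from TensorProduct.zero_tmul _ _] at this

end Crossed

namespace IsCrossedProduct

open Crossed

/-- Normalisation of σ is not assumed: it follows by applying id ⊗ ε to (1 # 1)(1 # k) = 1 # k. -/
theorem cocycle_one_left (hσ : IsCrossedProduct w σ) (k : H) :
    σ (1 ⊗ₜ k) = counit (R := R) k • (1 : A) := by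
  have := congrArg (proj w σ) (hσ.one_mul (Crossed.mk w σ 1 k))
  rw [mk_mul_mk, sw_one _ (by fun_prop) (by fun_prop), sw_one _ (by fun_prop) (by fun_prop),
    map_sw (IsLin.linearMap _)] at this
  simp_rw [proj_mk, w.one_act, _root_.one_mul] at this
  rwa [sw_counit_right (fun x => σ (1 ⊗ₜ x)) (by fun_prop)] at this

theorem cocycle_one_right (hσ : IsCrossedProduct w σ) (h : H) :
    σ (h ⊗ₜ 1) = counit (R := R) h • (1 : A) := by
  have h₁ (c d : H) : sw R (fun e f => Crossed.mk w σ (σ (c ⊗ₜ e)) (d * f)) 1 =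
      Crossed.mk w σ (σ (c ⊗ₜ 1)) d := by
    rw [sw_one _ (by fun_prop) (by fun_prop), _root_.mul_one]
  have := congrArg (proj w σ) (hσ.mul_one (Crossed.mk w σ 1 h))
  rw [mk_one_left_mul] at this
  simp_rw [h₁, map_sw (IsLin.linearMap (proj w σ)), proj_mk] at this
  rwa [sw_counit_right (fun x => σ (x ⊗ₜ 1)) (by fun_prop)] at this

theorem mk_one_mul_mk (hσ : IsCrossedProduct w σ) (a b : A) (h : H) :
    Crossed.mk w σ a 1 * Crossed.mk w σ b h = Crossed.mk w σ (a * b) h := by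
  rw [mk_mul_mk, sw_one _ (by fun_prop) (by fun_prop), sw_one _ (by fun_prop) (by fun_prop)]
  simp_rw [w.one_act, hσ.cocycle_one_left, mul_smul_comm, _root_.mul_one, _root_.one_mul,
    (isLin_mk_left (w := w) (σ := σ) _ (IsLin.id (R := R))).map_smul]
  exact sw_counit_left (fun x => Crossed.mk w σ (a * b) x) (by fun_prop) h

theorem mk_mul_mk_one (hσ : IsCrossedProduct w σ) (b : A) (h : H) :
    Crossed.mk w σ 1 h * Crossed.mk w σ b 1 = sw R (fun x y => Crossed.mk w σ (w.act x b) y) h := by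
  have h₁ (x c d : H) : sw R (fun e f => Crossed.mk w σ (1 * (w.act x b * σ (c ⊗ₜ e))) (d * f)) 1 =
      counit (R := R) c • Crossed.mk w σ (w.act x b) d := by
    rw [sw_one _ (by fun_prop) (by fun_prop), _root_.mul_one, hσ.cocycle_one_right, _root_.one_mul,
      mul_smul_comm, _root_.mul_one, (isLin_mk_left (w := w) (σ := σ) _ (IsLin.id (R := R))).map_smul]
  simp_rw [mk_mul_mk, h₁]
  exact sw_congr fun x y => sw_counit_left (fun d => Crossed.mk w σ (w.act x b) d) (by fun_prop) y

/-- The ring structure on a crossed product. -/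
abbrev ring (hσ : IsCrossedProduct w σ) : Ring (Crossed w σ) :=
  { (inferInstance : NonUnitalNonAssocRing (Crossed w σ)) with
    mul_assoc := hσ.mul_assoc
    one := Crossed.mk w σ 1 1
    one_mul := hσ.one_mul
    mul_one := hσ.mul_one }

/-- The algebra structure on a crossed product. -/
abbrev algebra (hσ : IsCrossedProduct w σ) :
    letI := hσ.ring
    Algebra R (Crossed w σ) :=
  letI := hσ.ring
  Algebra.ofModule smul_mul_assoc mul_smul_comm

/-- A crossed product `A #_σ H`, presented through `a ↦ a # 1` and `h ↦ 1 # h`. -/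
def presentation (hσ : IsCrossedProduct w σ) :
    letI := hσ.ring
    letI := hσ.algebra
    CrossedPresentation w σ (coaction w σ) :=
  letI := hσ.ring
  letI := hσ.algebra
  have h₁ : ∀ a h, Crossed.mk w σ a 1 * Crossed.mk w σ 1 h = Crossed.mk w σ a h := fun a h => by
    rw [hσ.mk_one_mul_mk, _root_.mul_one]
  { ι := AlgHom.ofLinearMap (IsLin.toLinearMap (R := R) (isLin_mk_left (w := w) (σ := σ) 1 IsLin.id))
      rfl fun a b => (hσ.mk_one_mul_mk a b 1).symm
    γ := IsLin.toLinearMap (R := R) (isLin_mk_right (w := w) (σ := σ) 1 IsLin.id)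
    p := proj w σ
    exists_rep := fun b => ⟨b, by
      induction b using Crossed.induction_on with
      | mk a h => exact h₁ a h
      | add x y hx hy => exact (map_add _ _ _).trans (congrArg₂ _ hx hy)⟩
    p_apply := fun a h => (congrArg _ (h₁ a h)).trans (proj_mk a h)
    γ_one := rfl
    γ_mul_ι := fun h a => (hσ.mk_mul_mk_one a h).trans (sw_congr fun x y => (h₁ _ _).symm)
    γ_mul_γ := fun h k => (mk_one_left_mul h k).trans
      (sw_congr fun x y => sw_congr fun c d => (h₁ _ _).symm)
    δ_apply := fun a h => (congrArg _ (h₁ a h)).trans ((coaction_mk a h).trans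
      (sw_congr fun x y => congrArg (· ⊗ₜ[R] y) (h₁ a x).symm)) }

end IsCrossedProduct

end

end CrossedDuality

end

open CrossedDuality in
theorem mainTheorem12 {R H A : Type*} [CommRing R] [Ring H] [HopfAlgebra R H]
    [Ring A] [Algebra R A]
    (Sb : H →ₗ[R] H) (hSb : IsTwistedAntipode Sb)
    (w : WeakAction R H A) (σ τ : H ⊗[R] H →ₗ[R] A)
    (hσ : IsCrossedProduct w σ) (hτ : IsConvInverse σ τ)
    (U : RightModuleSubalgebra R H) (V : Submodule R (Module.Dual R H))
    (hV : ∀ g ∈ V, ∀ h : H, rightReg g h ∈ V)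
    (hVU : IsCompatible w σ τ Sb V U)
    (hα : Function.Injective (pairingMap (A ⊗[R] H) U.incl)) :
    ∃ e : Smash (Crossed.coaction w σ) U ≃ₗ[R] A ⊗[R] SmashSelf U,
      (∀ x y, e (x * y) = e x * e y) ∧
      ∀ hε : (1 : WithConv (Module.Dual R H)) ∈ U.toNonUnitalSubalgebra,
        e (Smash.mk _ U (Crossed.mk w σ 1 1) ⟨1, hε⟩) = 1 ⊗ₜ[R] Smash.mk _ U 1 ⟨1, hε⟩ := by
  let _ := hσ.ring
  let _ := hσ.algebra
  -- A #_σ H has A ⊗ H as its underlying module, so injectivity of α serves both for B # U and for A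
  -- ⊗ (H # U).
  exact hσ.presentation.exists_equiv hSb hτ hV hVU hα hα
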